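/- Let $A$ be a unital $C^*$-algebra, and let $\mathcal L_A$ (resp. $\mathcal B_A$) be the category of Hilbert $A$-modules and adjointable (resp. bounded) $A$-module homomorphisms. Let $(E,\beta)$ be a finite dimensional cochain complex in $\mathcal L_A$, i.e. $E^i=0$ for all but finitely many $i\in\mathbb Z$, and let $E^{even}=\bigoplus_{i\ even}E^i$, $E^{odd}=\bigoplus_{i\ odd}E^i$. Put $S=-i(\beta-\beta^*)$, an adjointable operator on $\bigoplus_i E^i$, and let $S^{even}:E^{even}\to E^{odd}$ be its restriction. We use the following notions. The compact operators are the norm closure of the linear span of the rank one operators $z\mapsto\langle x,z\rangle\, y$. An adjointable operator is Fredholm if it is invertible modulo compact operators. A complex $(C,\beta)$ in $\mathcal L_A$ is Fredholm if there is an adjointable $g$ of degree $-1$ on $C$ such that $\beta g+g\beta-I$ is compact. If a complex $C$ is homotopy equivalent in $\mathcal B_A$ to a finite dimensional complex $F$ of finitely generated Hilbert $A$-modules (these are automatically projective), its Euler characteristic is $\chi(C)=\sum_i(-1)^i[F^i]\in K_0(A)$. The index $\operatorname{Ind}T$ of a Fredholm operator $T:X\to Y$ is the Euler characteristic of the complex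 $X\xrightarrow{T}Y$ in degrees $0$ and $1$. If $S$ is Fredholm, then $E$ is a Fredholm complex and $S^{even}$ is a Fredholm operator; the Euler characteristic $\chi(E)$ and the index $\operatorname{Ind}S^{even}$ exist and do not depend on the choice of $F$; and $$\operatorname{Ind}S^{even}=\chi(E)\in K_0(A).$$ -/

import Mathlib

open CategoryTheory

universe u

/-! ### Finitely generated Hilbert modules are projective -/

section FGProjective

set_option linter.unusedSectionVars false

variable {A : Type u} [CStarAlgebra A] [PartialOrder A] [StarOrderedRing A]
  {X : Type u} [NormedAddCommGroup X] [NormedSpace ℂ X] [Module A X] [CStarModule A X]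

theorem hilb_inner_ext {x y : X} (h : ∀ z : X, inner A z x = inner A z y) : x = y := by
  have h0 : inner A (x - y) (x - y) = 0 := by
    rw [CStarModule.inner_sub_right, h, sub_self]
  exact sub_eq_zero.mp (CStarModule.inner_self.mp h0)

theorem hilb_smul_assoc (z : ℂ) (a : A) (x : X) : (z • a) • x = z • (a • x) :=
  hilb_inner_ext (A := A) fun w => by simp

theorem hilb_norm_smul_le (a : A) (x : X) : ‖a • x‖ ≤ ‖a‖ * ‖x‖ := by
  have h : ‖a • x‖ ^ 2 ≤ (‖a‖ * ‖x‖) ^ 2 := by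
    rw [CStarModule.norm_sq_eq A, CStarModule.inner_op_smul_right,
      CStarModule.inner_op_smul_left, mul_pow, CStarModule.norm_sq_eq A (x := x)]
    calc ‖a * (inner A x x * star a)‖ ≤ ‖a‖ * (‖inner A x x‖ * ‖star a‖) :=
          (norm_mul_le _ _).trans (by gcongr; exact norm_mul_le _ _)
      _ = ‖a‖ ^ 2 * ‖inner A x x‖ := by rw [norm_star]; ring
  exact (pow_le_pow_iff_left₀ (norm_nonneg _) (by positivity) two_ne_zero).mp h

variable (A) in
/-- The map `a ↦ a • x`. -/
noncomputable def hilbSMulCLM (x : X) : A →L[ℂ] X :=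
  LinearMap.mkContinuous
    { toFun := fun a => a • x
      map_add' := fun a b => add_smul a b x
      map_smul' := fun z a => hilb_smul_assoc z a x } ‖x‖
    (fun a => by simpa [mul_comm] using hilb_norm_smul_le a x)

@[simp] theorem hilbSMulCLM_apply (x : X) (a : A) : hilbSMulCLM A x a = a • x := rfl

variable [CompleteSpace X]

theorem hilb_isUnit_of_bddBelow (T : X →L[ℂ] X) (K : ℝ) (hK : 0 < K)
    (h : ∀ t : ℝ, 0 ≤ t → ∀ x, ‖x‖ ≤ K * ‖T x + (t : ℂ) • x‖) : IsUnit T := by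
  rcases subsingleton_or_nontrivial X with hX | hX
  · have : T = 1 := by ext x; exact Subsingleton.elim _ _
    rw [this]; exact isUnit_one
  set P : ℝ → X →L[ℂ] X := fun t => T + (t : ℂ) • (1 : X →L[ℂ] X) with hP
  have hdiff : ∀ s t : ℝ, ‖P s - P t‖ = |s - t| := by
    intro s t
    have : P s - P t = ((s - t : ℝ) : ℂ) • (1 : X →L[ℂ] X) := by
      simp only [hP]; push_cast; module
    rw [this, norm_smul, norm_one, mul_one, Complex.norm_real, Real.norm_eq_abs]
  have step : ∀ s t : ℝ, 0 ≤ t → IsUnit (P t) → |s - t| < K⁻¹ → IsUnit (P s) := by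
    rintro s t ht ⟨v, hv⟩ hst
    have hinv : ‖((v⁻¹ : (X →L[ℂ] X)ˣ) : X →L[ℂ] X)‖ ≤ K := by
      refine ContinuousLinearMap.opNorm_le_bound _ hK.le fun y => ?_
      have h1 := h t ht ((v⁻¹ : (X →L[ℂ] X)ˣ).1 y)
      have h2 : (P t) ((v⁻¹ : (X →L[ℂ] X)ˣ).1 y) = y := by
        rw [← hv, ← mul_apply_eq_comp]; simp
      simp only [hP, _root_.add_apply, smul_apply,
        one_apply_eq_self] at h2
      rwa [h2] at h1
    refine ⟨Units.ofNearby v (P s) ?_, rfl⟩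
    rw [hv, hdiff]
    exact hst.trans_le (inv_anti₀ (Units.norm_pos v⁻¹) hinv)
  set δ : ℝ := K⁻¹ / 2 with hδ
  have hK' : 0 < K⁻¹ := inv_pos.mpr hK
  set t0 : ℝ := ‖T‖ + 1 with ht0
  have h0 : IsUnit (P t0) := by
    have ht0pos : 0 < t0 := by positivity
    have hne : (t0 : ℂ) ≠ 0 := by exact_mod_cast ht0pos.ne'
    let w : (X →L[ℂ] X)ˣ := Units.mk ((t0 : ℂ) • 1) ((t0 : ℂ)⁻¹ • 1)
      (by rw [smul_mul_smul_comm, mul_inv_cancel₀ hne, one_smul, one_mul])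
      (by rw [smul_mul_smul_comm, inv_mul_cancel₀ hne, one_smul, one_mul])
    refine ⟨Units.ofNearby w (P t0) ?_, rfl⟩
    have e1 : P t0 - (w : X →L[ℂ] X) = T := by simp [hP, w]
    have e2 : ‖((w⁻¹ : (X →L[ℂ] X)ˣ) : X →L[ℂ] X)‖ = t0⁻¹ := by
      change ‖(t0 : ℂ)⁻¹ • (1 : X →L[ℂ] X)‖ = _
      rw [norm_smul, norm_one, mul_one, norm_inv, Complex.norm_real, Real.norm_eq_abs,
        abs_of_pos ht0pos]
    rw [e1, e2, inv_inv]; simp [ht0]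
  have hind : ∀ k : ℕ, IsUnit (P (max (t0 - k * δ) 0)) := by
    intro k
    induction k with
    | zero => simpa [max_eq_left (show (0 : ℝ) ≤ t0 by positivity)] using h0
    | succ k ih =>
      refine step _ _ (le_max_right _ _) ih ?_
      refine (abs_max_sub_max_le_abs _ _ _).trans_lt ?_
      have : t0 - ((k + 1 : ℕ) : ℝ) * δ - (t0 - k * δ) = -δ := by push_cast; ring
      rw [this, abs_neg, abs_of_pos (by positivity)]
      rw [hδ]; linarith
  obtain ⟨k, hk⟩ := exists_nat_ge (t0 / δ)
  have hk' := hind k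
  have hle : t0 - k * δ ≤ 0 := by
    have := (div_le_iff₀ (show 0 < δ by positivity)).mp hk
    linarith
  rw [max_eq_right hle] at hk'
  simpa [hP] using hk'

/-- A finitely generated Hilbert module over a unital C⋆-algebra is projective. -/
theorem hilb_projective_of_finite [Module.Finite A X] : Module.Projective A X := by
  obtain ⟨n, f, hf⟩ := Module.Finite.exists_fin' A X
  set e : Fin n → X := fun i => f (Pi.single i 1) with he
  have hfe : ∀ a, f a = ∑ i, a i • e i := fun a => by
    conv_lhs => rw [← Finset.univ_sum_single a]
    rw [map_sum]
    refine Finset.sum_congr rfl fun i _ => ?_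
    rw [he, ← map_smul, ← Pi.single_smul, smul_eq_mul, mul_one]
  let F : (Fin n → A) →L[ℂ] X := ∑ i, (hilbSMulCLM A (e i)).comp (ContinuousLinearMap.proj i)
  have hF : ∀ a, F a = f a := fun a => by simp [F, hfe]
  have hFs : Function.Surjective F := fun y => by
    obtain ⟨a, ha⟩ := hf y
    exact ⟨a, by rw [hF, ha]⟩
  obtain ⟨C, hC, hCp⟩ := F.exists_preimage_norm_le hFs
  let Θ : X →L[ℂ] X := ∑ i, (hilbSMulCLM A (e i)).comp (CStarModule.innerSL (A := A) (e i))
  have hΘ : ∀ x, Θ x = ∑ i, (inner A (e i) x : A) • e i := fun x => by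
    simp [Θ, CStarModule.innerSL_apply]
  have hlow : ∀ t : ℝ, 0 ≤ t → ∀ x, ‖x‖ ≤ ((C * n) ^ 2 + 1) * ‖Θ x + (t : ℂ) • x‖ := by
    intro t ht x
    set y := Θ x + (t : ℂ) • x with hy
    have hp : ∀ i, (0 : A) ≤ inner A (e i) x * star (inner A (e i) x) :=
      fun i => mul_star_self_nonneg _
    have hQ : inner A x y = ∑ i, inner A (e i) x * star (inner A (e i) x)
        + (t : ℂ) • inner A x x := by
      rw [hy, CStarModule.inner_add_right, hΘ, CStarModule.inner_sum_right]
      simp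
    have hti : (0 : A) ≤ (t : ℂ) • inner A x x := by
      have : (t : ℂ) • inner A x x = t • inner A x x := by simp
      rw [this]
      exact smul_nonneg ht CStarModule.inner_self_nonneg
    have hi : ∀ i, ‖inner A (e i) x‖ ^ 2 ≤ ‖inner A x y‖ := by
      intro i
      rw [sq, ← CStarRing.norm_self_mul_star]
      refine CStarAlgebra.norm_le_norm_of_nonneg_of_le (hp i) ?_
      rw [hQ]
      exact (Finset.single_le_sum (fun j _ => hp j) (Finset.mem_univ i)).trans
        (le_add_of_nonneg_right hti)
    obtain ⟨a, ha, hna⟩ := hCp x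
    have hsq : ‖x‖ ^ 2 ≤ ‖x‖ * (C * n * √‖inner A x y‖) := by
      have h1 : inner A x x = ∑ i, a i * inner A x (e i) := by
        conv_lhs => rw [← ha, hF, hfe, CStarModule.inner_sum_right]
        simp only [CStarModule.inner_op_smul_right]
        rw [← hfe, ← hF, ha]
      rw [CStarModule.norm_sq_eq A, h1]
      calc _ ≤ ∑ i, ‖a i * inner A x (e i)‖ := norm_sum_le _ _
        _ ≤ ∑ _i : Fin n, (C * ‖x‖) * √‖inner A x y‖ := by
            refine Finset.sum_le_sum fun i _ => (norm_mul_le _ _).trans ?_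
            gcongr
            · exact (norm_le_pi_norm a i).trans hna
            · rw [← CStarModule.star_inner, norm_star]
              exact Real.le_sqrt_of_sq_le (hi i)
        _ = _ := by simp; ring
    rcases eq_or_ne x 0 with rfl | hx
    · simp; positivity
    have hxp : 0 < ‖x‖ := norm_pos_iff.mpr hx
    have h2 : ‖x‖ ≤ C * n * √‖inner A x y‖ := by
      rw [sq] at hsq; exact le_of_mul_le_mul_left hsq hxp
    have h3 : ‖x‖ ^ 2 ≤ (C * n) ^ 2 * ‖inner A x y‖ := by
      calc ‖x‖ ^ 2 ≤ (C * n * √‖inner A x y‖) ^ 2 := by gcongr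
        _ = _ := by rw [mul_pow, Real.sq_sqrt (norm_nonneg _)]
    have h4 : ‖x‖ * ‖x‖ ≤ ‖x‖ * ((C * n) ^ 2 * ‖y‖) := by
      calc ‖x‖ * ‖x‖ = ‖x‖ ^ 2 := (sq _).symm
        _ ≤ (C * n) ^ 2 * (‖x‖ * ‖y‖) := h3.trans (by gcongr; exact CStarModule.norm_inner_le X)
        _ = _ := by ring
    have h5 := le_of_mul_le_mul_left h4 hxp
    nlinarith [norm_nonneg y]
  obtain ⟨v, hv⟩ := hilb_isUnit_of_bddBelow Θ ((C * n) ^ 2 + 1) (by positivity) hlow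
  have hr : ∀ x, Θ ((v⁻¹ : (X →L[ℂ] X)ˣ).1 x) = x := fun x => by
    rw [← hv, ← mul_apply_eq_comp]; simp
  have hl : ∀ x, (v⁻¹ : (X →L[ℂ] X)ˣ).1 (Θ x) = x := fun x => by
    rw [← hv, ← mul_apply_eq_comp]; simp
  have hΘa : ∀ (a : A) x, Θ (a • x) = a • Θ x := fun a x => by
    simp [hΘ, Finset.smul_sum, mul_smul]
  have hva : ∀ (a : A) x, (v⁻¹ : (X →L[ℂ] X)ˣ).1 (a • x) = a • (v⁻¹ : (X →L[ℂ] X)ˣ).1 x :=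
    fun a x => by
      conv_lhs => rw [← hr x, ← hΘa, hl]
  refine Module.Projective.of_split (M := Fin n → A)
    { toFun := fun x i => inner A (e i) ((v⁻¹ : (X →L[ℂ] X)ˣ).1 x)
      map_add' := fun x y => by ext i; simp
      map_smul' := fun a x => by ext i; simp [hva] } f ?_
  ext x
  simp only [LinearMap.comp_apply, LinearMap.coe_mk, AddHom.coe_mk, LinearMap.id_apply]
  rw [hfe, ← hΘ, hr]

end FGProjective

/-! ### Hilbert modules and the categories of adjointable and of bounded homomorphisms -/

/-- A Hilbert module over the C⋆-algebra `A`: a complete `A`-module with an `A`-valued inner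
product, the norm being the one given by the inner product. -/
structure HilbertModule (A : Type u) [CStarAlgebra A] [PartialOrder A] [StarOrderedRing A] where
  carrier : Type u
  [normedAddCommGroup : NormedAddCommGroup carrier]
  [normedSpace : NormedSpace ℂ carrier]
  [module : Module A carrier]
  [cstarModule : CStarModule A carrier]
  [completeSpace : CompleteSpace carrier]

section Categories

variable {A : Type u} [CStarAlgebra A] [PartialOrder A] [StarOrderedRing A]

namespace HilbertModule

instance : CoeSort (HilbertModule A) (Type u) := ⟨HilbertModule.carrier⟩

attribute [instance] normedAddCommGroup normedSpace module cstarModule completeSpace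

/-- The bounded `A`-module homomorphisms from `X` to `Y`. -/
def bounded (X Y : HilbertModule A) : Submodule ℂ (X →L[ℂ] Y) where
  carrier := {T | ∀ (a : A) (x : X), T (a • x) = a • T x}
  add_mem' := fun {S T} hS hT a x => by simp [hS a x, hT a x]
  zero_mem' := fun a x => by simp
  smul_mem' := fun z T hT a x => by
    refine hilb_inner_ext (A := A) fun w => ?_
    simp [hT a x]

/-- The adjointable operators from `X` to `Y`. -/
def adjointable (X Y : HilbertModule A) : Submodule ℂ (X →L[ℂ] Y) where
  carrier := {T | ∃ T' : Y →L[ℂ] X, ∀ x y, inner A (T x) y = inner A x (T' y)}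
  add_mem' := by
    rintro S T ⟨S', hS⟩ ⟨T', hT⟩
    exact ⟨S' + T', fun x y => by simp [hS, hT]⟩
  zero_mem' := ⟨0, fun x y => by simp⟩
  smul_mem' := by
    rintro z T ⟨T', hT⟩
    exact ⟨star z • T', fun x y => by simp [hT]⟩

theorem adjointable_le_bounded (X Y : HilbertModule A) : adjointable X Y ≤ bounded X Y := by
  rintro T ⟨T', hT⟩ a x
  refine hilb_inner_ext (A := A) fun w => ?_
  have h : ∀ x, inner A w (T x) = inner A (T' w) x := fun x => by
    rw [← CStarModule.star_inner, hT, CStarModule.star_inner]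
  simp [h]

/-- The category `𝓛_A` of Hilbert `A`-modules and adjointable operators. -/
instance : Category (HilbertModule A) where
  Hom X Y := adjointable X Y
  id X := ⟨ContinuousLinearMap.id ℂ X, ContinuousLinearMap.id ℂ X, fun _ _ => rfl⟩
  comp {X Y Z} S T := ⟨T.1.comp S.1, by
    obtain ⟨S', hS⟩ := S.2
    obtain ⟨T', hT⟩ := T.2
    exact ⟨S'.comp T', fun x y => by simp [hS, hT]⟩⟩

instance : Preadditive (HilbertModule A) where
  homGroup X Y := inferInstanceAs (AddCommGroup (adjointable X Y))
  add_comp X Y Z f f' g := by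
    apply Subtype.ext; ext x; exact map_add g.1 (f.1 x) (f'.1 x)
  comp_add X Y Z f g g' := by
    apply Subtype.ext; ext x; rfl

instance : Linear ℂ (HilbertModule A) where
  homModule X Y := inferInstanceAs (Module ℂ (adjointable X Y))
  smul_comp X Y Z r f g := by
    apply Subtype.ext; ext x; exact map_smul g.1 r (f.1 x)
  comp_smul X Y Z f r g := by
    apply Subtype.ext; ext x; rfl

/-- The bounded operator underlying a morphism of `𝓛_A`. -/
def toCLM {X Y : HilbertModule A} (T : X ⟶ Y) : X →L[ℂ] Y := Subtype.val T

theorem toCLM_mem {X Y : HilbertModule A} (T : X ⟶ Y) : toCLM T ∈ adjointable X Y :=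
  Subtype.property T

/-- An adjointable operator as a morphism of `𝓛_A`. -/
def ofMem {X Y : HilbertModule A} (T : X →L[ℂ] Y) (hT : T ∈ adjointable X Y) : X ⟶ Y :=
  Subtype.mk T hT

/-- The adjoint of an adjointable operator. -/
noncomputable def adjoint {X Y : HilbertModule A} (T : X ⟶ Y) : Y ⟶ X :=
  ofMem (toCLM_mem T).choose ⟨toCLM T, fun y x => by
    rw [← CStarModule.star_inner, ← (toCLM_mem T).choose_spec, CStarModule.star_inner]⟩

theorem inner_adjoint {X Y : HilbertModule A} (T : X ⟶ Y) (x : X) (y : Y) :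
    inner A (toCLM T x) y = inner A x (toCLM (adjoint T) y) :=
  (toCLM_mem T).choose_spec x y

instance : Limits.HasZeroObject (HilbertModule A) := by
  let _ : Module A PUnit.{u + 1} := PUnit.module
  let _ : CStarModule A PUnit.{u + 1} :=
    { inner := fun _ _ => 0
      inner_add_right := by simp
      inner_self_nonneg := le_rfl
      inner_self := by simp
      inner_op_smul_right := by simp
      inner_smul_right_complex := by simp
      star_inner := by simp
      norm_eq_sqrt_norm_inner_self := by simp }
  refine ⟨⟨PUnit.{u + 1}⟩, ?_⟩
  rw [Limits.IsZero.iff_id_eq_zero]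
  apply Subtype.ext
  ext x

/-- The compact operators from `X` to `Y`: the norm closure of the linear span of the rank one
operators `z ↦ ⟪x, z⟫ y`. -/
noncomputable def compacts (X Y : HilbertModule A) : Submodule ℂ (X →L[ℂ] Y) :=
  (Submodule.span ℂ {T : X →L[ℂ] Y |
    ∃ (x : X) (y : Y), ∀ z : X, T z = (inner A x z : A) • y}).topologicalClosure

/-- The adjointable operator `T` is compact. -/
def IsCompactOp {X Y : HilbertModule A} (T : X ⟶ Y) : Prop :=
  toCLM T ∈ compacts X Y

/-- An adjointable operator is Fredholm if it is invertible modulo compact operators. -/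
def IsFredholm {X Y : HilbertModule A} (T : X ⟶ Y) : Prop :=
  ∃ G : Y ⟶ X, IsCompactOp (T ≫ G - 𝟙 X) ∧ IsCompactOp (G ≫ T - 𝟙 Y)

open WithCStarModule in
/-- The direct sum of finitely many Hilbert modules, with inner product `∑ i, ⟪x i, y i⟫`. -/
noncomputable def directSum {ι : Type} [Fintype ι] (X : ι → HilbertModule A) :
    HilbertModule A where
  carrier := C⋆ᵐᵒᵈ(A, Π i, X i)

open WithCStarModule in
/-- The bounded operator between direct sums with the matrix `M`. -/
noncomputable def matrixCLM {ι κ : Type} [Fintype ι] [Fintype κ] {X : ι → HilbertModule A}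
    {Y : κ → HilbertModule A} (M : ∀ i j, X i →L[ℂ] Y j) : directSum X →L[ℂ] directSum Y :=
  ((equivL ℂ (A := A) (E := Π j, Y j)).symm : (Π j, Y j) →L[ℂ] C⋆ᵐᵒᵈ(A, Π j, Y j)).comp
    ((ContinuousLinearMap.pi fun j => ∑ i, (M i j).comp (ContinuousLinearMap.proj i)).comp
      (equivL ℂ (A := A) (E := Π i, X i) : C⋆ᵐᵒᵈ(A, Π i, X i) →L[ℂ] (Π i, X i)))

theorem inner_matrixCLM {ι κ : Type} [Fintype ι] [Fintype κ] {X : ι → HilbertModule A}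
    {Y : κ → HilbertModule A} (M : ∀ i j, X i ⟶ Y j) (x : directSum X) (y : directSum Y) :
    inner A (matrixCLM (fun i j => toCLM (M i j)) x) y =
      inner A x (matrixCLM (fun j i => toCLM (adjoint (M i j))) y) := by
  change ∑ j, inner A (matrixCLM (fun i j => toCLM (M i j)) x j) (y j) =
    ∑ i, inner A (x i) (matrixCLM (fun j i => toCLM (adjoint (M i j))) y i)
  have h1 : ∀ j, matrixCLM (fun i j => toCLM (M i j)) x j = ∑ i, toCLM (M i j) (x i) :=
    fun j => by
      change (∑ i, (toCLM (M i j)).comp (ContinuousLinearMap.proj i)) _ = _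
      rw [sum_apply]; rfl
  have h2 : ∀ i, matrixCLM (fun j i => toCLM (adjoint (M i j))) y i =
      ∑ j, toCLM (adjoint (M i j)) (y j) :=
    fun i => by
      change (∑ j, (toCLM (adjoint (M i j))).comp (ContinuousLinearMap.proj j)) _ = _
      rw [sum_apply]; rfl
  simp only [h1, h2, CStarModule.inner_sum_left, CStarModule.inner_sum_right, inner_adjoint]
  exact Finset.sum_comm

/-- The adjointable operator between direct sums with the matrix `M`, that is
`(M x) j = ∑ i, M i j (x i)`. -/
noncomputable def matrixHom {ι κ : Type} [Fintype ι] [Fintype κ] {X : ι → HilbertModule A}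
    {Y : κ → HilbertModule A} (M : ∀ i j, X i ⟶ Y j) : directSum X ⟶ directSum Y :=
  ofMem (matrixCLM fun i j => toCLM (M i j))
    ⟨matrixCLM fun j i => toCLM (adjoint (M i j)), inner_matrixCLM M⟩

end HilbertModule

variable (A) in
/-- A Hilbert `A`-module as an object of the category `𝓑_A` of Hilbert `A`-modules and bounded
`A`-module homomorphisms. -/
structure BoundedHilbertModule where
  toHilbertModule : HilbertModule A

namespace BoundedHilbertModule

open HilbertModule

instance : Category (BoundedHilbertModule A) where
  Hom X Y := bounded X.toHilbertModule Y.toHilbertModule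
  id X := ⟨ContinuousLinearMap.id ℂ X.toHilbertModule, fun _ _ => rfl⟩
  comp {X Y Z} S T := ⟨T.1.comp S.1, fun a x => by
    change T.1 (S.1 (a • x)) = a • T.1 (S.1 x)
    rw [S.2, T.2]⟩

instance : Preadditive (BoundedHilbertModule A) where
  homGroup X Y := inferInstanceAs (AddCommGroup (bounded X.toHilbertModule Y.toHilbertModule))
  add_comp X Y Z f f' g := by
    apply Subtype.ext; ext x; exact map_add g.1 (f.1 x) (f'.1 x)
  comp_add X Y Z f g g' := by
    apply Subtype.ext; ext x; rfl

variable (A) in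
/-- The inclusion of `𝓛_A` in `𝓑_A`. -/
def ofAdjointable : HilbertModule A ⥤ BoundedHilbertModule A where
  obj X := ⟨X⟩
  map {X Y} T := Subtype.mk (toCLM T) (adjointable_le_bounded X Y (toCLM_mem T))

instance : (ofAdjointable A).Additive where
  map_add := rfl

end BoundedHilbertModule

end Categories

/-! ### The group `K₀` -/

/-- A finitely generated projective module over the ring `R`. -/
structure FGProjective (R : Type u) [Ring R] where
  carrier : Type u
  [addCommGroup : AddCommGroup carrier]
  [module : Module R carrier]
  [finite : Module.Finite R carrier]
  [projective : Module.Projective R carrier]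

namespace FGProjective

variable {R : Type u} [Ring R]

attribute [instance] addCommGroup module finite projective

instance setoid (R : Type u) [Ring R] : Setoid (FGProjective R) where
  r M N := Nonempty (M.carrier ≃ₗ[R] N.carrier)
  iseqv :=
    { refl := fun M => ⟨LinearEquiv.refl R M.carrier⟩
      symm := fun ⟨e⟩ => ⟨e.symm⟩
      trans := fun ⟨e⟩ ⟨f⟩ => ⟨e.trans f⟩ }

/-- The isomorphism classes of finitely generated projective modules. -/
def Classes (R : Type u) [Ring R] : Type (u + 1) := Quotient (setoid R)

/-- Isomorphism classes are added by taking direct sums. -/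
instance : Add (Classes R) where
  add := Quotient.map₂ (fun M N => ⟨M.carrier × N.carrier⟩)
    (fun _ _ ⟨e⟩ _ _ ⟨f⟩ => ⟨e.prodCongr f⟩)

instance : Zero (Classes R) where
  zero := Quotient.mk _ ⟨PUnit.{u + 1}⟩

instance : AddCommMonoid (Classes R) where
  add_assoc := by
    rintro ⟨M⟩ ⟨N⟩ ⟨P⟩
    exact Quotient.sound ⟨LinearEquiv.prodAssoc R _ _ _⟩
  zero_add := by
    rintro ⟨M⟩
    exact Quotient.sound ⟨LinearEquiv.uniqueProd⟩
  add_zero := by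
    rintro ⟨M⟩
    exact Quotient.sound ⟨LinearEquiv.prodUnique⟩
  add_comm := by
    rintro ⟨M⟩ ⟨N⟩
    exact Quotient.sound ⟨LinearEquiv.prodComm R _ _⟩
  nsmul := nsmulRec

end FGProjective

/-- `K₀(R)`, the Grothendieck group of the monoid of isomorphism classes of finitely generated
projective modules. -/
abbrev KZero (R : Type u) [Ring R] : Type (u + 1) :=
  Algebra.GrothendieckAddGroup (FGProjective.Classes R)

section Fredholm

variable {A : Type u} [CStarAlgebra A] [PartialOrder A] [StarOrderedRing A]

/-- The class in `K₀(A)` of a finitely generated Hilbert `A`-module. -/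
def HilbertModule.kClass (X : HilbertModule A) (hX : Module.Finite A X) : KZero A :=
  Algebra.GrothendieckAddGroup.of
    (Quotient.mk (FGProjective.setoid A)
      { carrier := X
        finite := hX
        projective := hilb_projective_of_finite })

/-! ### Fredholm complexes, Euler characteristic and index -/

/-- A complex in `𝓛_A` is Fredholm if there is a parametrix, an operator `g` of degree `-1`
such that `β g + g β - 1` is compact. Only the components `g i (i - 1)` matter. -/
def IsFredholmComplex (C : CochainComplex (HilbertModule A) ℤ) : Prop :=
  ∃ g : ∀ i j, C.X i ⟶ C.X j, ∀ i,
    HilbertModule.IsCompactOp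
      (g i (i - 1) ≫ C.d (i - 1) i + C.d i (i + 1) ≫ g (i + 1) i - 𝟙 (C.X i))

/-- The complex `C` in `𝓑_A` has Euler characteristic `x`: it is homotopy equivalent in `𝓑_A`
to a finite dimensional complex `F` of finitely generated modules with `x = ∑ (-1)ⁱ [Fⁱ]`. -/
def HasEulerChar (C : CochainComplex (BoundedHilbertModule A) ℤ) (x : KZero A) : Prop :=
  ∃ (F : CochainComplex (BoundedHilbertModule A) ℤ) (t : Finset ℤ)
    (hF : ∀ i, Module.Finite A (F.X i).toHilbertModule),
    (∀ i ∉ t, Limits.IsZero (F.X i)) ∧ Nonempty (HomotopyEquiv C F) ∧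
      x = ∑ i ∈ t, i.negOnePow • (F.X i).toHilbertModule.kClass (hF i)

/-- A complex in `𝓛_A` regarded as a complex in `𝓑_A`. -/
noncomputable def toBounded (C : CochainComplex (HilbertModule A) ℤ) :
    CochainComplex (BoundedHilbertModule A) ℤ :=
  ((BoundedHilbertModule.ofAdjointable A).mapHomologicalComplex (ComplexShape.up ℤ)).obj C

open Classical in
/-- The Euler characteristic `χ(C)` of a complex in `𝓑_A` that has one. -/
noncomputable def eulerChar (C : CochainComplex (BoundedHilbertModule A) ℤ) : KZero A :=
  if h : ∃ x, HasEulerChar C x then h.choose else 0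

/-- The complex with the operator `T : X ⟶ Y` as its only differential, `X` being in degree `0`
and `Y` in degree `1`. -/
noncomputable def operatorComplex {X Y : HilbertModule A} (T : X ⟶ Y) :
    CochainComplex (HilbertModule A) ℤ :=
  HomologicalComplex.double T (c := ComplexShape.up ℤ) (i₀ := 0) (i₁ := 1) (zero_add 1)

/-- The operator `T` has index `x`. -/
def HasIndex {X Y : HilbertModule A} (T : X ⟶ Y) (x : KZero A) : Prop :=
  HasEulerChar (toBounded (operatorComplex T)) x

/-- The index of an operator: the Euler characteristic of the complex that it forms. -/
noncomputable def fredholmIndex {X Y : HilbertModule A} (T : X ⟶ Y) : KZero A :=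
  eulerChar (toBounded (operatorComplex T))

/-! ### The operator `S = -i(β - β*)` -/

/-- The component from `Eⁱ` to `Eʲ` of `S = -i(β - β*)`. -/
noncomputable def signatureComponent (E : CochainComplex (HilbertModule A) ℤ) (i j : ℤ) :
    E.X i ⟶ E.X j :=
  (-Complex.I) • (E.d i j - HilbertModule.adjoint (E.d j i))

/-- The direct sum of the modules `Eⁱ` with `i ∈ s`. -/
noncomputable def sumOver (E : CochainComplex (HilbertModule A) ℤ) (s : Finset ℤ) :
    HilbertModule A :=
  HilbertModule.directSum fun i : s => E.X i

/-- The part of `S = -i(β - β*)` that maps the sum of the `Eⁱ` with `i ∈ s` to the sum of the `Eʲ`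
with `j ∈ t`. -/
noncomputable def signatureBlock (E : CochainComplex (HilbertModule A) ℤ) (s t : Finset ℤ) :
    sumOver E s ⟶ sumOver E t :=
  HilbertModule.matrixHom fun (i : s) (j : t) => signatureComponent E i j

/-- The operator `S = -i(β - β*)` on the total module of a complex that vanishes outside `s`. -/
noncomputable def signatureOp (E : CochainComplex (HilbertModule A) ℤ) (s : Finset ℤ) :
    sumOver E s ⟶ sumOver E s :=
  signatureBlock E s s

/-- The operator `S` from the even to the odd part of a complex that vanishes outside `s`. -/
noncomputable def signatureEven (E : CochainComplex (HilbertModule A) ℤ) (s : Finset ℤ) :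
    sumOver E {i ∈ s | Even i} ⟶ sumOver E {i ∈ s | Odd i} :=
  signatureBlock E {i ∈ s | Even i} {i ∈ s | Odd i}

end Fredholm

/-! Fredholmness. Since β² = 0, the square of S is ββ* + β*β, a diagonal operator with one Laplacian
Δ in each degree. Squaring a parametrix of S and compressing it to one degree gives a parametrix P
of Δ. As Δ commutes with β, so does P modulo compacts, and Pβ* is then a parametrix of the complex E
(`isFredholmComplex_of_isFredholm`). As S exchanges parities, compressing its parametrix also gives
one for S^even (`isFredholm_signatureEven`).

Existence of χ(E). A compact operator is within distance 1 of a finite rank operator, and the latter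
factors through a finitely generated module. So in 𝓑_A the identity of E is homotopic to a chain map
that factors degreewise through such modules (`isHomotopyFinite_of_isFredholmComplex`). Going down
from the top degree, each module is then made finitely generated by adding one contractible complex
and splitting off another (`IsHomotopyFinite.exists_homotopyEquiv`).

Index. Let ψ : F → E be a homotopy equivalence in 𝓑_A with F finitely generated. Bounded
homomorphisms out of finitely generated modules are adjointable (`mem_adjointable_of_finite`), so
the mapping cone of ψ has adjointable differentials, although its contraction is only bounded.
Folded by parity, the cone consists of D : F_odd ⊕ E_even → F_even ⊕ E_odd and a map D' in the other
direction. Contractibility makes D - D'* and its adjoint bounded below, hence D - D'* is invertible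
(`isIso_sub_adjoint`). Its corner E_even → E_odd is β - β* = iS^even. A corner of an invertible two
by two matrix forms a complex homotopy equivalent to that of the complementary corner of the inverse
(`cornerHomotopyEquiv`), here a map F_even → F_odd. Hence the index is [F_even] - [F_odd] = χ(E)
(`hasIndex_signatureEven`).

Independence of F. For two finitely generated models F and F', the same construction gives F'_odd ⊕
F_even ≅ F'_even ⊕ F_odd, which is the equality of their Euler characteristics
(`sum_negOnePow_kClass_eq`). -/

/-! ### Complexes that are finite up to homotopy -/

section Finiteness

set_option linter.unusedSectionVars false

open Limits

universe v w

variable {V : Type w} [Category.{v} V] [Preadditive V]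

/-- A property of objects that holds for zero objects and is inherited by retracts and by
binary direct sums. -/
structure IsAdditiveProperty [HasBinaryBiproducts V] (P : V → Prop) : Prop where
  zero : ∀ X, IsZero X → P X
  retract : ∀ {X Y : V} (i : X ⟶ Y) (p : Y ⟶ X), i ≫ p = 𝟙 X → P Y → P X
  biprod : ∀ {X Y : V}, P X → P Y → P (X ⊞ Y)

/-- The morphism `f` factors through an object with the property `P`. -/
def FactorsThrough (P : V → Prop) {X Y : V} (f : X ⟶ Y) : Prop :=
  ∃ (Z : V) (_ : P Z) (a : X ⟶ Z) (b : Z ⟶ Y), f = a ≫ b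

namespace FactorsThrough

variable {P : V → Prop}

theorem comp_left {X Y Z : V} {f : Y ⟶ Z} (hf : FactorsThrough P f) (g : X ⟶ Y) :
    FactorsThrough P (g ≫ f) := by
  obtain ⟨W, hW, a, b, rfl⟩ := hf
  exact ⟨W, hW, g ≫ a, b, by simp⟩

theorem comp_right {X Y Z : V} {f : X ⟶ Y} (hf : FactorsThrough P f) (g : Y ⟶ Z) :
    FactorsThrough P (f ≫ g) := by
  obtain ⟨W, hW, a, b, rfl⟩ := hf
  exact ⟨W, hW, a, b ≫ g, by simp⟩

theorem neg {X Y : V} {f : X ⟶ Y} (hf : FactorsThrough P f) : FactorsThrough P (-f) := by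
  obtain ⟨W, hW, a, b, rfl⟩ := hf
  exact ⟨W, hW, a, -b, by simp⟩

theorem of_tgt {X Y : V} (hY : P Y) (f : X ⟶ Y) : FactorsThrough P f :=
  ⟨Y, hY, f, 𝟙 Y, by simp⟩

variable [HasBinaryBiproducts V]

/-- The biproduct of the two middle objects serves both summands. Thus the morphisms that factor
through `P` form a two-sided ideal, and one can calculate modulo `P`. -/
theorem add (hP : IsAdditiveProperty P) {X Y : V} {f g : X ⟶ Y}
    (hf : FactorsThrough P f) (hg : FactorsThrough P g) :
    FactorsThrough P (f + g) := by
  obtain ⟨W, hW, a, b, rfl⟩ := hf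
  obtain ⟨W', hW', a', b', rfl⟩ := hg
  exact ⟨W ⊞ W', hP.biprod hW hW', biprod.lift a a', biprod.desc b b', by simp⟩

theorem sub (hP : IsAdditiveProperty P) {X Y : V} {f g : X ⟶ Y}
    (hf : FactorsThrough P f) (hg : FactorsThrough P g) :
    FactorsThrough P (f - g) := by
  rw [sub_eq_add_neg]
  exact FactorsThrough.add hP hf hg.neg

theorem of_id (hP : IsAdditiveProperty P) {X : V} (h : FactorsThrough P (𝟙 X)) : P X := by
  obtain ⟨W, hW, a, b, h⟩ := h
  exact hP.retract a b h.symm hW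

end FactorsThrough

/-- The identity of `C` is homotopic to an endomorphism that factors in each degree through an
object with the property `P`. -/
def IsHomotopyFinite (P : V → Prop) (C : CochainComplex V ℤ) : Prop :=
  ∃ f : C ⟶ C, Nonempty (Homotopy f (𝟙 C)) ∧ ∀ i, FactorsThrough P (f.f i)

theorem IsHomotopyFinite.of_homotopyEquiv {P : V → Prop} {C D : CochainComplex V ℤ}
    (hC : IsHomotopyFinite P C) (e : HomotopyEquiv C D) : IsHomotopyFinite P D := by
  obtain ⟨f, ⟨h⟩, hf⟩ := hC
  refine ⟨e.inv ≫ f ≫ e.hom, ⟨?_⟩, fun i => ?_⟩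
  · exact ((h.compRightId e.hom).compLeft e.inv).trans e.homotopyInvHomId
  · simpa using ((hf i).comp_right (e.hom.f i)).comp_left (e.inv.f i)

theorem homotopy_id_cochain {C : CochainComplex V ℤ} {f : C ⟶ C} (h : Homotopy f (𝟙 C))
    {i j k : ℤ} (hij : i + 1 = j) (hjk : j + 1 = k) :
    f.f j = C.d j k ≫ h.hom k j + h.hom j i ≫ C.d i j + 𝟙 (C.X j) := by
  have := h.comm j
  rwa [dNext_eq h.hom (show (ComplexShape.up ℤ).Rel j k from hjk),
    prevD_eq h.hom (show (ComplexShape.up ℤ).Rel i j from hij)] at this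

/-! ### Complexes concentrated in two adjacent degrees -/

section Double

variable [HasZeroObject V] {X₀ X₁ : V} {f : X₀ ⟶ X₁} {i j : ℤ}
  (hij : (ComplexShape.up ℤ).Rel i j)

theorem ne_of_up_rel {i j : ℤ} (hij : (ComplexShape.up ℤ).Rel i j) : i ≠ j := by
  change i + 1 = j at hij
  omega

/-- Constructor for morphisms to a complex in two degrees. -/
noncomputable def mkHomToDouble {C : CochainComplex V ℤ} (φ₀ : C.X i ⟶ X₀) (φ₁ : C.X j ⟶ X₁)
    (comm : φ₀ ≫ f = C.d i j ≫ φ₁) (hφ : ∀ k, C.d k i ≫ φ₀ = 0) :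
    C ⟶ HomologicalComplex.double f hij where
  f k :=
    if hk₀ : k = i then
      eqToHom (by subst hk₀; rfl) ≫ φ₀ ≫
        (HomologicalComplex.doubleXIso₀ f hij).inv ≫ eqToHom (by subst hk₀; rfl)
    else if hk₁ : k = j then
      eqToHom (by subst hk₁; rfl) ≫ φ₁ ≫
        (HomologicalComplex.doubleXIso₁ f hij (ne_of_up_rel hij)).inv ≫
          eqToHom (by subst hk₁; rfl)
    else 0
  comm' k₀ k₁ hk := by
    have hne := ne_of_up_rel hij
    by_cases h₁ : k₁ = j
    · subst h₁
      obtain rfl : k₀ = i := by change k₀ + 1 = k₁ at hk; change i + 1 = k₁ at hij; omega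
      simp [hne.symm, HomologicalComplex.double_d _ _ hne, reassoc_of% comm]
    · rw [HomologicalComplex.double_d_eq_zero₁ _ _ _ _ h₁, comp_zero]
      by_cases h₀ : k₁ = i
      · subst h₀
        simp [reassoc_of% hφ]
      · simp [h₀, h₁]

@[simp]
theorem mkHomToDouble_f₀ {C : CochainComplex V ℤ} (φ₀ : C.X i ⟶ X₀) (φ₁ : C.X j ⟶ X₁)
    (comm : φ₀ ≫ f = C.d i j ≫ φ₁) (hφ : ∀ k, C.d k i ≫ φ₀ = 0) :
    (mkHomToDouble hij φ₀ φ₁ comm hφ).f i =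
      φ₀ ≫ (HomologicalComplex.doubleXIso₀ f hij).inv := by
  simp [mkHomToDouble]

@[simp]
theorem mkHomToDouble_f₁ {C : CochainComplex V ℤ} (φ₀ : C.X i ⟶ X₀) (φ₁ : C.X j ⟶ X₁)
    (comm : φ₀ ≫ f = C.d i j ≫ φ₁) (hφ : ∀ k, C.d k i ≫ φ₀ = 0) :
    (mkHomToDouble hij φ₀ φ₁ comm hφ).f j =
      φ₁ ≫ (HomologicalComplex.doubleXIso₁ f hij (ne_of_up_rel hij)).inv := by
  simp [mkHomToDouble, (ne_of_up_rel hij).symm]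

/-- Constructor for homotopies between endomorphisms of a complex in two degrees. -/
noncomputable def mkHomotopyDouble {α β : HomologicalComplex.double f hij ⟶
    HomologicalComplex.double f hij} (s : X₁ ⟶ X₀)
    (h₀ : α.f i - β.f i = (HomologicalComplex.doubleXIso₀ f hij).hom ≫ (f ≫ s) ≫
      (HomologicalComplex.doubleXIso₀ f hij).inv)
    (h₁ : α.f j - β.f j = (HomologicalComplex.doubleXIso₁ f hij (ne_of_up_rel hij)).hom ≫
      (s ≫ f) ≫ (HomologicalComplex.doubleXIso₁ f hij (ne_of_up_rel hij)).inv) :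
    Homotopy α β :=
  Homotopy.equivSubZero.symm <| (Homotopy.ofEq (by
    have hne := ne_of_up_rel hij
    apply HomologicalComplex.from_double_hom_ext
    · rw [Homotopy.nullHomotopicMap'_f (show (ComplexShape.up ℤ).Rel (i - 1) i from by simp) hij,
        HomologicalComplex.double_d_eq_zero₁ _ _ _ _ hne]
      simp [HomologicalComplex.double_d _ _ hne, h₀]
    · rw [Homotopy.nullHomotopicMap'_f hij (show (ComplexShape.up ℤ).Rel j (j + 1) from rfl),
        HomologicalComplex.double_d_eq_zero₀ _ _ _ _ hne.symm]
      simp [HomologicalComplex.double_d _ _ hne, h₁])).trans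
  (Homotopy.nullHomotopy' (C := HomologicalComplex.double f hij)
    (D := HomologicalComplex.double f hij) fun k l _ => if h : k = j ∧ l = i then
      eqToHom (by obtain ⟨rfl, -⟩ := h; rfl) ≫
        (HomologicalComplex.doubleXIso₁ f hij (ne_of_up_rel hij)).hom ≫ s ≫
        (HomologicalComplex.doubleXIso₀ f hij).inv ≫ eqToHom (by obtain ⟨-, rfl⟩ := h; rfl)
      else 0)

variable (X : V)

/-- The contractible complex `X = X` in two adjacent degrees. -/
noncomputable abbrev elementaryComplex : CochainComplex V ℤ :=
  HomologicalComplex.double (𝟙 X) hij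

/-- Elementary complexes are contractible. -/
noncomputable def elementaryHomotopy : Homotopy (𝟙 (elementaryComplex hij X)) 0 :=
  mkHomotopyDouble hij (𝟙 X) (by simp) (by simp)

variable {X}

/-- The map out of an elementary complex given by a morphism in the lower degree. -/
noncomputable def fromElementary {C : CochainComplex V ℤ} (g : X ⟶ C.X i) :
    elementaryComplex hij X ⟶ C :=
  HomologicalComplex.mkHomFromDouble _ (ne_of_up_rel hij) g (g ≫ C.d i j) (by simp) (by simp)

/-- The map to an elementary complex given by a morphism in the upper degree. -/
noncomputable def toElementary {C : CochainComplex V ℤ} (g : C.X j ⟶ X) :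
    C ⟶ elementaryComplex hij X :=
  mkHomToDouble hij (C.d i j ≫ g) g (by simp) (by simp)

end Double

/-- Adding a contractible summand and splitting one off does not change the homotopy type. -/
theorem exists_homotopyEquiv_of_split [HasBinaryBiproducts V] [IsIdempotentComplete V]
    {C K L : CochainComplex V ℤ} (hK : Homotopy (𝟙 K) 0) (hL : Homotopy (𝟙 L) 0)
    (σ : L ⟶ C ⊞ K) (ρ : C ⊞ K ⟶ L) (h : σ ≫ ρ = 𝟙 L) :
    ∃ (C' : CochainComplex V ℤ) (i : C' ⟶ C ⊞ K) (p : C ⊞ K ⟶ C'), i ≫ p = 𝟙 C' ∧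
      p ≫ i = 𝟙 _ - ρ ≫ σ ∧ Nonempty (HomotopyEquiv C C') := by
  obtain ⟨C', i, p, hip, hpi⟩ := IsIdempotentComplete.idempotents_split (C ⊞ K)
    (𝟙 _ - ρ ≫ σ) (by simp [reassoc_of% h])
  refine ⟨C', i, p, hip, hpi, ⟨⟨biprod.inl ≫ p, i ≫ biprod.fst, ?_, ?_⟩⟩⟩
  -- Both composites differ from the identity by a map through a contractible complex: through `L`
  -- here, through `K` in the other order.
  · have e : (biprod.inl ≫ p) ≫ i ≫ biprod.fst =
        𝟙 C + (biprod.inl ≫ ρ) ≫ 𝟙 L ≫ (-σ ≫ biprod.fst) := by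
      simp [reassoc_of% hpi, sub_eq_add_neg]
    exact (Homotopy.ofEq e).trans ((((Homotopy.refl _).add
      ((hL.compRight _).compLeft _))).trans (Homotopy.ofEq (by simp)))
  · have e : (i ≫ biprod.fst) ≫ biprod.inl ≫ p =
        𝟙 C' + (i ≫ biprod.snd) ≫ 𝟙 K ≫ (-biprod.inr ≫ p) := by
      have := biprod.total (X := C) (Y := K)
      calc (i ≫ biprod.fst) ≫ biprod.inl ≫ p =
          i ≫ (biprod.fst ≫ biprod.inl + biprod.snd ≫ biprod.inr) ≫ p
            + (i ≫ biprod.snd) ≫ 𝟙 K ≫ (-biprod.inr ≫ p) := by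
            simp only [Preadditive.add_comp, Preadditive.comp_add, Preadditive.comp_neg,
              Category.assoc, Category.id_comp]
            abel
        _ = _ := by rw [this, Category.id_comp, hip]
    exact (Homotopy.ofEq e).trans ((((Homotopy.refl _).add
      ((hK.compRight _).compLeft _))).trans (Homotopy.ofEq (by simp)))

variable [HasZeroObject V] [HasBinaryBiproducts V] [IsIdempotentComplete V]
  {P : V → Prop}

/-- The object in degree `j` of a complex can be replaced by one with the property `P` if the
differential to it is surjective up to `P`. -/
theorem exists_homotopyEquiv_step (hP : IsAdditiveProperty P) (C : CochainComplex V ℤ) {i j : ℤ}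
    (hij : (ComplexShape.up ℤ).Rel i j) (g : C.X j ⟶ C.X i)
    (hg : FactorsThrough P (𝟙 (C.X j) - g ≫ C.d i j)) :
    ∃ C' : CochainComplex V ℤ, Nonempty (HomotopyEquiv C C') ∧ P (C'.X j) ∧
      ∀ k, k ≠ i → k ≠ j → ∃ (a : C'.X k ⟶ C.X k) (b : C.X k ⟶ C'.X k), a ≫ b = 𝟙 _ := by
  obtain ⟨Z, hZ, a, b, hab⟩ := hg
  have hne := ne_of_up_rel hij
  have hgd : g ≫ C.d i j + a ≫ b = 𝟙 _ := by rw [← hab]; abel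
  -- Add `Z = Z` to `C` and split off `C.X j = C.X j`. The splitting is the identity `g ≫ d + a ≫ b
  -- = 𝟙`. In degree `j` the maps `𝟙` and `b` send `C.X j ⊕ Z` onto `C.X j`, which leaves a copy of
  -- `Z`; the price is a larger object in degree `i`.
  let K := elementaryComplex hij Z
  let L := elementaryComplex hij (C.X j)
  let σ₁ : L ⟶ C := fromElementary hij g
  let σ₂ : L ⟶ K := fromElementary hij (a ≫ (HomologicalComplex.doubleXIso₀ (𝟙 Z) hij).inv)
  let ρ₁ : C ⟶ L := toElementary hij (𝟙 _)
  let ρ₂ : K ⟶ L := toElementary hij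
    ((HomologicalComplex.doubleXIso₁ (𝟙 Z) hij hne).hom ≫ b)
  have hσρ : σ₁ ≫ ρ₁ + σ₂ ≫ ρ₂ = 𝟙 L := by
    have hKd : K.d i j = (HomologicalComplex.doubleXIso₀ (𝟙 Z) hij).hom ≫ 𝟙 Z ≫
        (HomologicalComplex.doubleXIso₁ (𝟙 Z) hij hne).inv := HomologicalComplex.double_d _ _ hne
    apply HomologicalComplex.from_double_hom_ext
    · have : (HomologicalComplex.doubleXIso₀ (𝟙 (C.X j)) hij).hom ≫ (g ≫ C.d i j + a ≫ b) ≫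
          (HomologicalComplex.doubleXIso₀ (𝟙 (C.X j)) hij).inv = 𝟙 (L.X i) := by simp [hgd, L]
      rw [HomologicalComplex.id_f, ← this]
      simp [σ₁, σ₂, ρ₁, ρ₂, fromElementary, toElementary, hKd]
    · have : (HomologicalComplex.doubleXIso₁ (𝟙 (C.X j)) hij hne).hom ≫
          (g ≫ C.d i j + a ≫ b) ≫
          (HomologicalComplex.doubleXIso₁ (𝟙 (C.X j)) hij hne).inv = 𝟙 (L.X j) := by
        simp [hgd, L]
      rw [HomologicalComplex.id_f, ← this]
      simp [σ₁, σ₂, ρ₁, ρ₂, fromElementary, toElementary, hKd]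
  obtain ⟨C', ι, p, hιp, hpι, ⟨e⟩⟩ := exists_homotopyEquiv_of_split
    (elementaryHomotopy hij Z) (elementaryHomotopy hij (C.X j))
    (biprod.lift σ₁ σ₂) (biprod.desc ρ₁ ρ₂) (by simpa using hσρ)
  have hιpf : ∀ k, ι.f k ≫ p.f k = 𝟙 _ := fun k => by
    rw [← HomologicalComplex.comp_f, hιp, HomologicalComplex.id_f]
  have htot : ∀ k, (biprod.fst : C ⊞ K ⟶ C).f k ≫ (biprod.inl : C ⟶ C ⊞ K).f k +
      (biprod.snd : C ⊞ K ⟶ K).f k ≫ (biprod.inr : K ⟶ C ⊞ K).f k = 𝟙 _ := fun k => by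
    rw [← HomologicalComplex.comp_f, ← HomologicalComplex.comp_f,
      ← HomologicalComplex.add_f_apply, biprod.total, HomologicalComplex.id_f]
  refine ⟨C', ⟨e⟩, ?_, fun k hki hkj => ?_⟩
  · apply FactorsThrough.of_id hP
    have h1 : 𝟙 (C'.X j) = ι.f j ≫ ((p ≫ ι).f j) ≫ p.f j := by
      simp [hιpf]
    rw [h1, hpι]
    refine FactorsThrough.comp_left (FactorsThrough.comp_right ?_ _) _
    have hK : P (K.X j) := hP.retract (HomologicalComplex.doubleXIso₁ (𝟙 Z) hij hne).hom
      (HomologicalComplex.doubleXIso₁ (𝟙 Z) hij hne).inv (by simp) hZ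
    have hx := htot j
    have hmain : FactorsThrough P ((biprod.inl : C ⟶ C ⊞ K).f j ≫
        (𝟙 (C ⊞ K) - biprod.desc ρ₁ ρ₂ ≫ biprod.lift σ₁ σ₂).f j ≫
          (biprod.fst : C ⊞ K ⟶ C).f j) := by
      have e : (biprod.inl : C ⟶ C ⊞ K) ≫ (𝟙 (C ⊞ K) - biprod.desc ρ₁ ρ₂ ≫ biprod.lift σ₁ σ₂) ≫
          (biprod.fst : C ⊞ K ⟶ C) = 𝟙 C - ρ₁ ≫ σ₁ := by simp
      rw [← HomologicalComplex.comp_f, ← HomologicalComplex.comp_f, e]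
      refine ⟨Z, hZ, a, b, ?_⟩
      rw [← hab]
      simp [σ₁, ρ₁, fromElementary, toElementary]
    -- The corner of the idempotent on `C` is `𝟙 - g ≫ d = a ≫ b`, by `hmain`; every other corner
    -- starts or ends in `K.X j ≅ Z`. So the idempotent, and with it the identity of its image,
    -- factors through `P`.
    set x := (𝟙 (C ⊞ K) - biprod.desc ρ₁ ρ₂ ≫ biprod.lift σ₁ σ₂).f j
    have hdec : x = (biprod.fst : C ⊞ K ⟶ C).f j ≫ ((biprod.inl : C ⟶ C ⊞ K).f j ≫ x ≫
          (biprod.fst : C ⊞ K ⟶ C).f j) ≫ (biprod.inl : C ⟶ C ⊞ K).f j +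
        ((biprod.snd : C ⊞ K ⟶ K).f j ≫ (biprod.inr : K ⟶ C ⊞ K).f j ≫ x +
        (biprod.fst : C ⊞ K ⟶ C).f j ≫ (biprod.inl : C ⟶ C ⊞ K).f j ≫ x ≫
          (biprod.snd : C ⊞ K ⟶ K).f j ≫ (biprod.inr : K ⟶ C ⊞ K).f j) := by
      have h2 : (biprod.fst : C ⊞ K ⟶ C).f j ≫ (biprod.inl : C ⟶ C ⊞ K).f j ≫ x =
          x - (biprod.snd : C ⊞ K ⟶ K).f j ≫ (biprod.inr : K ⟶ C ⊞ K).f j ≫ x := by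
        rw [eq_sub_iff_add_eq, ← Category.assoc, ← Category.assoc _ _ x, ← Preadditive.add_comp,
          hx, Category.id_comp]
      have h3 : (biprod.fst : C ⊞ K ⟶ C).f j ≫ (biprod.inl : C ⟶ C ⊞ K).f j =
          𝟙 _ - (biprod.snd : C ⊞ K ⟶ K).f j ≫ (biprod.inr : K ⟶ C ⊞ K).f j :=
        eq_sub_iff_add_eq.mpr hx
      simp only [Category.assoc]
      rw [reassoc_of% h2, reassoc_of% h2, h3]
      simp only [Preadditive.sub_comp, Preadditive.comp_sub, Category.comp_id, Category.assoc]
      abel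
    rw [hdec]
    refine .add hP ((hmain.comp_right _).comp_left _) (.add hP ?_ ?_)
    · exact (FactorsThrough.of_tgt hK _).comp_right _
    · exact ((((FactorsThrough.of_tgt hK _).comp_right _).comp_left _).comp_left _).comp_left _
  · have hz : IsZero (K.X k) := HomologicalComplex.isZero_double_X _ _ k hki hkj
    refine ⟨ι.f k ≫ (biprod.fst : C ⊞ K ⟶ C).f k, (biprod.inl : C ⟶ C ⊞ K).f k ≫ p.f k, ?_⟩
    have := htot k
    rw [hz.eq_of_tgt ((biprod.snd : C ⊞ K ⟶ K).f k) 0, zero_comp, add_zero] at this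
    simp only [Category.assoc]
    rw [reassoc_of% this, hιpf]

/-- A bounded complex that is homotopy finite with respect to `P` is homotopy equivalent to a
bounded complex of objects with the property `P`. -/
theorem IsHomotopyFinite.exists_homotopyEquiv (hP : IsAdditiveProperty P)
    {C : CochainComplex V ℤ} (hC : IsHomotopyFinite P C) (m n : ℤ)
    (hz : ∀ i, i < m ∨ n < i → IsZero (C.X i)) :
    ∃ F : CochainComplex V ℤ, Nonempty (HomotopyEquiv C F) ∧ (∀ i, P (F.X i)) ∧
      ∀ i, i < m - 1 ∨ n < i → IsZero (F.X i) := by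
  -- Descending induction from the top degree. Treating degree `m` may create a nonzero object in
  -- degree `m - 1`, but nothing below it.
  have key : ∀ r : ℕ, ∃ F : CochainComplex V ℤ, Nonempty (HomotopyEquiv C F) ∧
      (∀ i, n - r < i → P (F.X i)) ∧ ∀ i, i < m - 1 ∨ n < i → IsZero (F.X i) := by
    intro r
    induction r with
    | zero =>
      exact ⟨C, ⟨.refl C⟩, fun i hi => hP.zero _ (hz i (by simp at hi; omega)),
        fun i hi => hz i (by omega)⟩
    | succ r ih =>
      obtain ⟨F, ⟨e⟩, hF, hF0⟩ := ih
      obtain ⟨f, ⟨h⟩, hf⟩ := hC.of_homotopyEquiv e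
      set j : ℤ := n - r with hj
      have hk : FactorsThrough P (F.d j (j + 1) ≫ h.hom (j + 1) j) :=
        (FactorsThrough.of_tgt (hF (j + 1) (by omega)) _).comp_right _
      have hcomm := homotopy_id_cochain h (show j - 1 + 1 = j by omega) rfl
      -- The homotopy formula gives `𝟙 + h ≫ d = f - d ≫ h`. Here `f` is in the ideal and `d ≫ h`
      -- passes through degree `j + 1`, which already has `P`; so `-h` is the approximate section
      -- needed for the step.
      have h1 : FactorsThrough P
          (𝟙 (F.X j) - (-h.hom j (j - 1)) ≫ F.d (j - 1) j) := by
        have : 𝟙 (F.X j) - (-h.hom j (j - 1)) ≫ F.d (j - 1) j =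
            f.f j - F.d j (j + 1) ≫ h.hom (j + 1) j := by
          rw [hcomm, Preadditive.neg_comp]; abel
        rw [this]
        exact .sub hP (hf j) hk
      by_cases hjm : m ≤ j
      · obtain ⟨F', ⟨e'⟩, hF'j, hF'⟩ := exists_homotopyEquiv_step hP F
          (show (ComplexShape.up ℤ).Rel (j - 1) j from by simp) _ h1
        refine ⟨F', ⟨e.trans e'⟩, fun i hi => ?_, fun i hi => ?_⟩
        · by_cases hij : i = j
          · exact hij ▸ hF'j
          · push_cast at hi
            obtain ⟨a, b, hab⟩ := hF' i (by omega) hij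
            exact hP.retract a b hab (hF i (by omega))
        · obtain ⟨a, b, hab⟩ := hF' i (by omega) (by omega)
          rw [IsZero.iff_id_eq_zero, ← hab, (hF0 i hi).eq_of_tgt a 0, zero_comp]
      -- Below degree `m` no modification is needed: `F.X (j - 1)` is zero, so the term `h ≫ d`
      -- vanishes and the identity of `F.X j` itself factors through `P`.
      · refine ⟨F, ⟨e⟩, fun i hi => ?_, hF0⟩
        by_cases hij : i = j
        · rw [hij]
          apply FactorsThrough.of_id hP
          rwa [(hF0 (j - 1) (by omega)).eq_of_tgt (h.hom j (j - 1)) 0, neg_zero, zero_comp,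
            sub_zero] at h1
        · push_cast at hi
          exact hF i (by omega)
  obtain ⟨F, e, hF, hF0⟩ := key (n - m + 2).toNat
  refine ⟨F, e, fun i => ?_, hF0⟩
  by_cases hi : i < m - 1
  · exact hP.zero _ (hF0 i (Or.inl hi))
  · exact hF i (by omega)

end Finiteness

/-! ### Two-term complexes and block matrices -/

section BlockMatrices

set_option linter.unusedSectionVars false

open Limits

universe v w

variable {V : Type w} [Category.{v} V] [Preadditive V]

/-- If an isomorphism `X ⊕ P ≅ Y ⊕ Q` has the component `T : X ⟶ Y` and its inverse has the
component `c' : Q ⟶ P`, then the complexes formed by `T` and by `c'` are homotopy equivalent. -/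
noncomputable def doubleHomotopyEquiv [HasZeroObject V] {X Y P Q : V} {T : X ⟶ Y} {b : P ⟶ Y}
    {a : X ⟶ Q} {c : P ⟶ Q} {T' : Y ⟶ X} {a' : Y ⟶ P} {b' : Q ⟶ X} {c' : Q ⟶ P}
    (hXP : T ≫ a' + a ≫ c' = 0) (hQY : b' ≫ T + c' ≫ b = 0)
    (hX : T ≫ T' + a ≫ b' = 𝟙 X) (hY : T' ≫ T + a' ≫ b = 𝟙 Y)
    (hQ : b' ≫ a + c' ≫ c = 𝟙 Q) (hP : b ≫ a' + c ≫ c' = 𝟙 P)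
    {i j : ℤ} (hij : (ComplexShape.up ℤ).Rel i j) :
    HomotopyEquiv (HomologicalComplex.double T hij) (HomologicalComplex.double c' hij) where
  -- The off-diagonal entries of the two matrices are the chain maps, with a sign in the upper
  -- degree. The remaining diagonal entries `T'` and `c`, negated, are the homotopies.
  hom := mkHomToDouble hij ((HomologicalComplex.doubleXIso₀ T hij).hom ≫ a)
    (-(HomologicalComplex.doubleXIso₁ T hij (ne_of_up_rel hij)).hom ≫ a')
    (by
      rw [HomologicalComplex.double_d _ _ (ne_of_up_rel hij)]
      simp [eq_neg_of_add_eq_zero_right hXP])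
    (fun k => by
      rw [HomologicalComplex.double_d_eq_zero₁ _ _ _ _ (ne_of_up_rel hij), zero_comp])
  inv := mkHomToDouble hij ((HomologicalComplex.doubleXIso₀ c' hij).hom ≫ b')
    (-(HomologicalComplex.doubleXIso₁ c' hij (ne_of_up_rel hij)).hom ≫ b)
    (by
      rw [HomologicalComplex.double_d _ _ (ne_of_up_rel hij)]
      simp [eq_neg_of_add_eq_zero_left hQY])
    (fun k => by
      rw [HomologicalComplex.double_d_eq_zero₁ _ _ _ _ (ne_of_up_rel hij), zero_comp])
  homotopyHomInvId := mkHomotopyDouble hij (-T')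
    (by
      have : T ≫ T' = 𝟙 X - a ≫ b' := eq_sub_of_add_eq hX
      simp [this])
    (by
      have : T' ≫ T = 𝟙 Y - a' ≫ b := eq_sub_of_add_eq hY
      simp [this])
  homotopyInvHomId := mkHomotopyDouble hij (-c)
    (by
      have : c' ≫ c = 𝟙 Q - b' ≫ a := eq_sub_of_add_eq' hQ
      simp [this])
    (by
      have : c ≫ c' = 𝟙 P - b ≫ a' := eq_sub_of_add_eq' hP
      simp [this])

/-- A complex concentrated in two adjacent degrees is determined by its differential. -/
noncomputable def isoDouble [HasZeroObject V] {X Y : V} {T : X ⟶ Y} {i j : ℤ}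
    (hij : (ComplexShape.up ℤ).Rel i j) (C : CochainComplex V ℤ) (e₀ : C.X i ≅ X) (e₁ : C.X j ≅ Y)
    (comm : e₀.hom ≫ T = C.d i j ≫ e₁.hom) (hz : ∀ k, k ≠ i → k ≠ j → IsZero (C.X k)) :
    C ≅ HomologicalComplex.double T hij where
  hom := mkHomToDouble hij e₀.hom e₁.hom comm fun k => by
    by_cases hk : k + 1 = i
    · have hij' : i + 1 = j := hij
      rw [(hz k (by omega) (by omega)).eq_of_src (C.d k i) 0, zero_comp]
    · rw [C.shape k i hk, zero_comp]
  inv := HomologicalComplex.mkHomFromDouble hij (ne_of_up_rel hij) e₀.inv e₁.inv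
    (by rw [Iso.inv_comp_eq, ← Category.assoc, comm, Category.assoc, e₁.hom_inv_id,
      Category.comp_id])
    (fun k hk => by
      have hij' : i + 1 = j := hij
      have hk' : j + 1 = k := hk
      rw [(hz k (by omega) (by omega)).eq_of_tgt (C.d j k) 0, comp_zero])
  hom_inv_id := by
    ext k
    by_cases h₀ : k = i
    · subst h₀
      simp
    by_cases h₁ : k = j
    · subst h₁
      simp
    exact (hz k h₀ h₁).eq_of_src _ _
  inv_hom_id := by
    apply HomologicalComplex.from_double_hom_ext <;> simp

/-- The matrix of the identity of a family of objects. -/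
def deltaHom {J : Type*} [DecidableEq J] (X : J → V) (i j : J) : X i ⟶ X j :=
  if h : i = j then eqToHom (by rw [h]) else 0

/-- The matrix of a chain map. -/
def diagHom {C D : CochainComplex V ℤ} (φ : C ⟶ D) (i j : ℤ) : C.X i ⟶ D.X j :=
  φ.f i ≫ deltaHom D.X i j

theorem deltaHom_self {J : Type*} [DecidableEq J] (X : J → V) (i : J) : deltaHom X i i = 𝟙 _ := by
  simp [deltaHom]

theorem deltaHom_of_ne {J : Type*} [DecidableEq J] (X : J → V) {i j : J} (h : i ≠ j) :
    deltaHom X i j = 0 := by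
  simp [deltaHom, h]

theorem diagHom_self {C D : CochainComplex V ℤ} (φ : C ⟶ D) (i : ℤ) : diagHom φ i i = φ.f i := by
  simp [diagHom, deltaHom_self]

theorem diagHom_of_ne {C D : CochainComplex V ℤ} (φ : C ⟶ D) {i j : ℤ} (h : i ≠ j) :
    diagHom φ i j = 0 := by
  simp [diagHom, deltaHom_of_ne _ h]

/-! ### Matrices of morphisms between finite direct sums -/

section Bicone

variable {J : Type*} {X Y Z : J → V} {s t r : Finset J}

/-- The bicone `b` is a direct sum. -/
def IsDirectSum (b : Bicone fun i : s => X i) : Prop := ∑ i, b.π i ≫ b.ι i = 𝟙 b.pt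

/-- The morphism between direct sums with the given matrix. -/
def blockHom (b : Bicone fun i : s => X i) (b' : Bicone fun i : t => Y i)
    (M : ∀ i j, X i ⟶ Y j) : b.pt ⟶ b'.pt :=
  ∑ i : s, ∑ j : t, b.π i ≫ M i j ≫ b'.ι j

variable (b : Bicone fun i : s => X i) (b' : Bicone fun i : t => Y i)
  (b'' : Bicone fun i : r => Z i)

theorem bicone_ι_π [DecidableEq J] (i j : s) : b.ι i ≫ b.π j = deltaHom X i j := by
  rw [b.ι_π]
  by_cases h : i = j
  · subst h; simp [deltaHom]
  · have : (i : J) ≠ j := fun h' => h (Subtype.ext h')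
    simp [deltaHom, h, this]

theorem blockHom_π [DecidableEq J] (M : ∀ i j, X i ⟶ Y j) (j : t) :
    blockHom b b' M ≫ b'.π j = ∑ i : s, b.π i ≫ M i j := by
  simp only [blockHom, Preadditive.sum_comp, Category.assoc, bicone_ι_π]
  refine Finset.sum_congr rfl fun i _ => ?_
  rw [Finset.sum_eq_single j, deltaHom_self]
  · simp
  · intro k _ hk
    rw [deltaHom_of_ne _ (fun h => hk (Subtype.ext h))]
    simp
  · simp

theorem blockHom_comp [DecidableEq J] (M : ∀ i j, X i ⟶ Y j) (N : ∀ i j, Y i ⟶ Z j) :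
    blockHom b b' M ≫ blockHom b' b'' N = blockHom b b'' fun i k => ∑ j ∈ t, M i j ≫ N j k := by
  have h : blockHom b b' M ≫ blockHom b' b'' N =
      ∑ j : t, ∑ k : r, (blockHom b b' M ≫ b'.π j) ≫ N j k ≫ b''.ι k := by
    rw [blockHom.eq_def b' b'']
    simp only [Preadditive.comp_sum, Category.assoc]
  rw [h]
  simp only [blockHom_π]
  simp only [blockHom, ← Finset.sum_coe_sort t, Preadditive.sum_comp,
    Preadditive.comp_sum, Category.assoc]
  rw [Finset.sum_comm, Finset.sum_comm (s := (Finset.univ : Finset s))]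
  exact Finset.sum_congr rfl fun k _ => Finset.sum_comm

theorem blockHom_congr {M N : ∀ i j, X i ⟶ Y j} (h : ∀ i ∈ s, ∀ j ∈ t, M i j = N i j) :
    blockHom b b' M = blockHom b b' N :=
  Finset.sum_congr rfl fun i _ => Finset.sum_congr rfl fun j _ => by rw [h i i.2 j j.2]

theorem blockHom_add (M N : ∀ i j, X i ⟶ Y j) :
    blockHom b b' M + blockHom b b' N = blockHom b b' fun i j => M i j + N i j := by
  simp [blockHom, Finset.sum_add_distrib]

theorem blockHom_zero : blockHom b b' (fun _ _ => 0) = 0 := by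
  simp [blockHom]

theorem blockHom_delta [DecidableEq J] (hb : IsDirectSum b) :
    blockHom b b (deltaHom X) = 𝟙 b.pt := by
  rw [← hb]
  refine Finset.sum_congr rfl fun i _ => ?_
  rw [Finset.sum_eq_single i, deltaHom_self, Category.id_comp]
  · intro k _ hk
    rw [deltaHom_of_ne _ (fun h => hk (Subtype.ext h.symm))]
    simp
  · simp

end Bicone

/-! ### Even and odd blocks of a complex -/

section Fold

/-- The finset `t` contains all neighbours of elements of `s` in which `C` does not vanish. -/
def CoversNeighbours (C : CochainComplex V ℤ) (s t : Finset ℤ) : Prop :=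
  ∀ i ∈ s, ∀ k, (i + 1 = k ∨ k + 1 = i) → k ∉ t → IsZero (C.X k)

variable {C D : CochainComplex V ℤ} {s s' t t' : Finset ℤ}
  (b : Bicone fun i : s => C.X i) (b' : Bicone fun i : s' => C.X i)
  (c : Bicone fun i : t => D.X i) (c' : Bicone fun i : t' => D.X i)

/-- The differential between two blocks of a complex. -/
def blockD : b.pt ⟶ b'.pt := blockHom b b' C.d

theorem blockD_comp_blockD (b'' : Bicone fun i : t => C.X i) :
    blockD b b' ≫ blockD b' b'' = 0 := by
  rw [blockD, blockD, blockHom_comp, ← blockHom_zero]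
  exact blockHom_congr _ _ fun i _ j _ => Finset.sum_eq_zero fun k _ => by simp

/-- Used for matrices supported on one diagonal: at most one index contributes to an entry of the
product, and if the finite set omits this index the object there is zero. -/
theorem sum_comp_eq_single {J : Type*} {Y : J → V} {X Z : V} {t : Finset J} (M : ∀ k, X ⟶ Y k)
    (N : ∀ k, Y k ⟶ Z) (k₀ : J) (h : ∀ k, k ≠ k₀ → M k = 0 ∨ N k = 0)
    (hk₀ : k₀ ∉ t → IsZero (Y k₀)) : ∑ k ∈ t, M k ≫ N k = M k₀ ≫ N k₀ := by
  refine Finset.sum_eq_single k₀ (fun k _ hk => ?_) fun hk => ?_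
  · rcases h k hk with h | h <;> simp [h]
  · rw [(hk₀ hk).eq_of_tgt (M k₀) 0, zero_comp]

theorem blockD_comp_diag (φ : C ⟶ D) (hC : ∀ i ∈ t', i ∉ s' → IsZero (C.X i))
    (hD : ∀ i ∈ s, i ∉ t → IsZero (D.X i)) :
    blockD b b' ≫ blockHom b' c' (diagHom φ) = blockHom b c (diagHom φ) ≫ blockD c c' := by
  rw [blockD, blockD, blockHom_comp, blockHom_comp]
  refine blockHom_congr _ _ fun i hi j hj => ?_
  rw [sum_comp_eq_single _ _ j (fun k hk => Or.inr (diagHom_of_ne φ hk)) (hC j hj),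
    sum_comp_eq_single _ _ i (fun k hk => Or.inl (diagHom_of_ne φ hk.symm)) (hD i hi),
    diagHom_self, diagHom_self, φ.comm]

theorem diag_comp_diag (φ : C ⟶ D) (ψ : D ⟶ C) (hD : ∀ i ∈ s, i ∉ t → IsZero (D.X i)) :
    blockHom b c (diagHom φ) ≫ blockHom c b (diagHom ψ) = blockHom b b (diagHom (φ ≫ ψ)) := by
  rw [blockHom_comp]
  refine blockHom_congr _ _ fun i hi j hj => ?_
  rw [sum_comp_eq_single _ _ i (fun k hk => Or.inl (diagHom_of_ne φ hk.symm)) (hD i hi),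
    diagHom_self]
  by_cases h : i = j
  · subst h
    simp [diagHom_self]
  · simp [diagHom_of_ne _ h]

/-- This is the homotopy formula read entrywise. The differential raises degrees by one and the
homotopy lowers them by one, so entries off the diagonal vanish; `CoversNeighbours` ensures that no
intermediate term is lost. -/
theorem diag_eq_of_homotopy {f : C ⟶ C} (h : Homotopy f (𝟙 C)) (hb : IsDirectSum b)
    (hs : CoversNeighbours C s s') :
    blockHom b b (diagHom f) =
      blockD b b' ≫ blockHom b' b h.hom + blockHom b b' h.hom ≫ blockD b' b + 𝟙 b.pt := by
  rw [← blockHom_delta b hb, blockD, blockD, blockHom_comp, blockHom_comp, blockHom_add,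
    blockHom_add]
  refine blockHom_congr _ _ fun i hi j hj => ?_
  rw [sum_comp_eq_single _ _ (i + 1) (fun k hk => Or.inl (C.shape _ _ fun h => hk h.symm))
      (hs i hi _ (Or.inl rfl)),
    sum_comp_eq_single _ _ (i - 1)
      (fun k hk => Or.inl (h.zero _ _ fun h => hk (eq_sub_of_add_eq h)))
      (hs i hi _ (Or.inr (sub_add_cancel _ _)))]
  by_cases hij : i = j
  · subst hij
    rw [diagHom_self, deltaHom_self, homotopy_id_cochain h (sub_add_cancel i 1) rfl]
  · rw [diagHom_of_ne _ hij, deltaHom_of_ne _ hij,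
      h.zero (i + 1) j (fun h => hij (add_right_cancel (b := 1) h).symm),
      C.shape (i - 1) j (fun h => hij ((sub_add_cancel i 1).symm.trans h))]
    simp

end Fold

end BlockMatrices

/-! ### The additive categories of Hilbert modules -/

section HilbertCategories

set_option linter.unusedSectionVars false

variable {A : Type u} [CStarAlgebra A] [PartialOrder A] [StarOrderedRing A]

namespace HilbertModule

variable {X Y Z : HilbertModule A}

theorem hom_ext {S T : X ⟶ Y} (h : ∀ x, toCLM S x = toCLM T x) : S = T :=
  Subtype.ext (ContinuousLinearMap.ext h)

@[simp] theorem toCLM_ofMem (T : X →L[ℂ] Y) (hT : T ∈ adjointable X Y) :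
    toCLM (ofMem T hT) = T := rfl

@[simp] theorem toCLM_comp (S : X ⟶ Y) (T : Y ⟶ Z) : toCLM (S ≫ T) = (toCLM T).comp (toCLM S) :=
  rfl

@[simp] theorem toCLM_id : toCLM (𝟙 X) = ContinuousLinearMap.id ℂ X := rfl

@[simp] theorem toCLM_zero : toCLM (0 : X ⟶ Y) = 0 := rfl

@[simp] theorem toCLM_add (S T : X ⟶ Y) : toCLM (S + T) = toCLM S + toCLM T := rfl

@[simp] theorem toCLM_neg (S : X ⟶ Y) : toCLM (-S) = -toCLM S := rfl

@[simp] theorem toCLM_sub (S T : X ⟶ Y) : toCLM (S - T) = toCLM S - toCLM T := rfl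

@[simp] theorem toCLM_smul (z : ℂ) (S : X ⟶ Y) : toCLM (z • S) = z • toCLM S := rfl

theorem toCLM_sum {ι : Type*} (s : Finset ι) (S : ι → (X ⟶ Y)) :
    toCLM (∑ i ∈ s, S i) = ∑ i ∈ s, toCLM (S i) :=
  map_sum (⟨⟨toCLM, rfl⟩, fun _ _ => rfl⟩ : (X ⟶ Y) →+ (X →L[ℂ] Y)) S s

theorem adjoint_eq {T : X ⟶ Y} {S : Y ⟶ X}
    (h : ∀ x y, inner A (toCLM T x) y = inner A x (toCLM S y)) : adjoint T = S :=
  hom_ext fun y => hilb_inner_ext (A := A) fun x => by rw [← inner_adjoint, h]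

@[simp] theorem adjoint_zero : adjoint (0 : X ⟶ Y) = 0 := adjoint_eq fun x y => by simp

theorem adjoint_comp (S : X ⟶ Y) (T : Y ⟶ Z) : adjoint (S ≫ T) = adjoint T ≫ adjoint S :=
  adjoint_eq fun x y => by simp [inner_adjoint]

/-! ### Finite direct sums of Hilbert modules -/

section DirectSum

open WithCStarModule

variable {ι : Type} [Fintype ι]

/-- The projection of a direct sum to a summand, as a bounded operator. -/
noncomputable def projCLM (X : ι → HilbertModule A) (i : ι) : directSum X →L[ℂ] X i :=
  (ContinuousLinearMap.proj i).comp
    (equivL ℂ (A := A) (E := Π i, X i) : C⋆ᵐᵒᵈ(A, Π i, X i) →L[ℂ] (Π i, X i))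

open Classical in
/-- The inclusion of a summand in a direct sum, as a bounded operator. -/
noncomputable def inclCLM (X : ι → HilbertModule A) (i : ι) : X i →L[ℂ] directSum X :=
  ((equivL ℂ (A := A) (E := Π i, X i)).symm : (Π i, X i) →L[ℂ] C⋆ᵐᵒᵈ(A, Π i, X i)).comp
    (ContinuousLinearMap.single ℂ (fun i => (X i : Type u)) i)

theorem directSum_ext {X : ι → HilbertModule A} {x y : directSum X}
    (h : ∀ i, projCLM X i x = projCLM X i y) : x = y :=
  funext h

theorem inner_directSum {X : ι → HilbertModule A} (x y : directSum X) :
    inner A x y = ∑ i, inner A (projCLM X i x) (projCLM X i y) := rfl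

open Classical in
theorem projCLM_inclCLM (X : ι → HilbertModule A) (i j : ι) (x : X i) :
    projCLM X j (inclCLM X i x) = Pi.single (M := fun i => (X i : Type u)) i x j := rfl

theorem projCLM_matrixCLM {κ : Type} [Fintype κ] {X : ι → HilbertModule A}
    {Y : κ → HilbertModule A} (M : ∀ i j, X i →L[ℂ] Y j) (x : directSum X) (j : κ) :
    projCLM Y j (matrixCLM M x) = ∑ i, M i j (projCLM X i x) := by
  change (∑ i, (M i j).comp (ContinuousLinearMap.proj i)) _ = _
  rw [sum_apply]; rfl

theorem inner_inclCLM (X : ι → HilbertModule A) (i : ι) (x : X i) (y : directSum X) :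
    inner A (inclCLM X i x) y = inner A x (projCLM X i y) := by
  classical
  rw [inner_directSum, Finset.sum_eq_single i]
  · rw [projCLM_inclCLM, Pi.single_eq_same]
  · intro j _ hj
    rw [projCLM_inclCLM, Pi.single_eq_of_ne hj, CStarModule.inner_zero_left]
  · simp

theorem inner_projCLM (X : ι → HilbertModule A) (i : ι) (x : directSum X) (y : X i) :
    inner A (projCLM X i x) y = inner A x (inclCLM X i y) := by
  rw [← CStarModule.star_inner, ← inner_inclCLM, CStarModule.star_inner]

/-- The projection of a direct sum to a summand. -/
noncomputable def projHom (X : ι → HilbertModule A) (i : ι) : directSum X ⟶ X i :=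
  ofMem (projCLM X i) ⟨inclCLM X i, inner_projCLM X i⟩

/-- The inclusion of a summand in a direct sum. -/
noncomputable def inclHom (X : ι → HilbertModule A) (i : ι) : X i ⟶ directSum X :=
  ofMem (inclCLM X i) ⟨projCLM X i, inner_inclCLM X i⟩

@[simp] theorem toCLM_projHom (X : ι → HilbertModule A) (i : ι) :
    toCLM (projHom X i) = projCLM X i := rfl

@[simp] theorem toCLM_inclHom (X : ι → HilbertModule A) (i : ι) :
    toCLM (inclHom X i) = inclCLM X i := rfl

theorem sum_projCLM_inclCLM (X : ι → HilbertModule A) (x : ∀ i, X i) (j : ι) :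
    ∑ i, projCLM X j (inclCLM X i (x i)) = x j := by
  classical
  rw [Finset.sum_eq_single j]
  · rw [projCLM_inclCLM, Pi.single_eq_same]
  · intro i _ hi
    rw [projCLM_inclCLM, Pi.single_eq_of_ne (Ne.symm hi)]
  · simp

theorem sum_projHom_inclHom (X : ι → HilbertModule A) :
    ∑ i, projHom X i ≫ inclHom X i = 𝟙 (directSum X) := by
  refine hom_ext fun x => directSum_ext fun j => ?_
  simp [toCLM_sum, sum_projCLM_inclCLM]

/-- This links the operators in the definition of `S` with the matrix calculus of `blockHom`. -/
theorem matrixHom_eq_sum {κ : Type} [Fintype κ] {X : ι → HilbertModule A} {Y : κ → HilbertModule A}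
    (M : ∀ i j, X i ⟶ Y j) :
    matrixHom M = ∑ i, ∑ j, projHom X i ≫ M i j ≫ inclHom Y j := by
  have h : toCLM (matrixHom M) = matrixCLM fun i j => toCLM (M i j) := rfl
  refine hom_ext fun x => directSum_ext fun j => ?_
  simp [toCLM_sum, sum_projCLM_inclCLM, h, projCLM_matrixCLM]

open Classical in
theorem inclHom_projHom (X : ι → HilbertModule A) (i j : ι) :
    inclHom X i ≫ projHom X j = if h : i = j then eqToHom (congrArg X h) else 0 := by
  split_ifs with h
  · subst h
    exact hom_ext fun x => by simp [projCLM_inclCLM]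
  · exact hom_ext fun x => by simp [projCLM_inclCLM, Pi.single_eq_of_ne (Ne.symm h)]

/-- The direct sum of Hilbert modules as a bicone in `𝓛_A`. -/
noncomputable def directSumBicone (X : ι → HilbertModule A) : Limits.Bicone X where
  pt := directSum X
  π := projHom X
  ι := inclHom X
  ι_π := inclHom_projHom X

theorem directSumBicone_total (X : ι → HilbertModule A) :
    ∑ i, (directSumBicone X).π i ≫ (directSumBicone X).ι i = 𝟙 (directSumBicone X).pt :=
  sum_projHom_inclHom X

end DirectSum

end HilbertModule

namespace BoundedHilbertModule

open HilbertModule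

variable {X Y Z : BoundedHilbertModule A}

/-- The bounded operator underlying a morphism of `𝓑_A`. -/
def clm (T : X ⟶ Y) : X.toHilbertModule →L[ℂ] Y.toHilbertModule := Subtype.val T

theorem clm_map_smul (T : X ⟶ Y) (a : A) (x : X.toHilbertModule) : clm T (a • x) = a • clm T x :=
  Subtype.property T a x

/-- A bounded module homomorphism as a morphism of `𝓑_A`. -/
def homMk (T : X.toHilbertModule →L[ℂ] Y.toHilbertModule)
    (hT : T ∈ bounded X.toHilbertModule Y.toHilbertModule) : X ⟶ Y :=
  Subtype.mk T hT

theorem hom_ext {S T : X ⟶ Y} (h : ∀ x, clm S x = clm T x) : S = T :=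
  Subtype.ext (ContinuousLinearMap.ext h)

@[simp] theorem clm_homMk (T : X.toHilbertModule →L[ℂ] Y.toHilbertModule)
    (hT : T ∈ bounded X.toHilbertModule Y.toHilbertModule) : clm (homMk T hT) = T := rfl

@[simp] theorem clm_comp (S : X ⟶ Y) (T : Y ⟶ Z) : clm (S ≫ T) = (clm T).comp (clm S) := rfl

@[simp] theorem clm_id : clm (𝟙 X) = ContinuousLinearMap.id ℂ X.toHilbertModule := rfl

@[simp] theorem clm_zero : clm (0 : X ⟶ Y) = 0 := rfl

@[simp] theorem clm_add (S T : X ⟶ Y) : clm (S + T) = clm S + clm T := rfl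

@[simp] theorem clm_neg (S : X ⟶ Y) : clm (-S) = -clm S := rfl

@[simp] theorem clm_sub (S T : X ⟶ Y) : clm (S - T) = clm S - clm T := rfl

@[simp] theorem clm_map {X Y : HilbertModule A} (T : X ⟶ Y) :
    clm ((ofAdjointable A).map T) = toCLM T := rfl

/-- The module homomorphism underlying a morphism of `𝓑_A`. -/
def linearMap (T : X ⟶ Y) : X.toHilbertModule →ₗ[A] Y.toHilbertModule where
  toFun := clm T
  map_add' := map_add _
  map_smul' := clm_map_smul T

instance : Limits.HasZeroObject (BoundedHilbertModule A) :=
  (Functor.map_isZero (ofAdjointable A)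
    (Limits.isZero_zero (HilbertModule A))).hasZeroObject

/-- The direct sum of Hilbert modules as a bicone in `𝓑_A`. -/
noncomputable def sumBicone {ι : Type} [Fintype ι] (X : ι → BoundedHilbertModule A) :
    Limits.Bicone X :=
  (ofAdjointable A).mapBicone (directSumBicone fun i => (X i).toHilbertModule)

theorem sumBicone_total {ι : Type} [Fintype ι] (X : ι → BoundedHilbertModule A) :
    ∑ i, (sumBicone X).π i ≫ (sumBicone X).ι i = 𝟙 (sumBicone X).pt := by
  have := congrArg (ofAdjointable A).map
    (directSumBicone_total fun i => (X i).toHilbertModule)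
  rwa [Functor.map_sum, CategoryTheory.Functor.map_id] at this

instance : Limits.HasFiniteBiproducts (BoundedHilbertModule A) where
  out _ := ⟨fun X => Limits.hasBiproduct_of_total (sumBicone X) (sumBicone_total X)⟩

instance : Limits.HasBinaryBiproducts (BoundedHilbertModule A) :=
  Limits.hasBinaryBiproducts_of_finite_biproducts _

end BoundedHilbertModule

end HilbertCategories

/-! ### Finitely generated Hilbert modules -/

section FinitelyGenerated

set_option linter.unusedSectionVars false

variable {A : Type u} [CStarAlgebra A] [PartialOrder A] [StarOrderedRing A]

namespace HilbertModule

instance (X : HilbertModule A) : IsScalarTower ℂ A X := ⟨fun z a x => hilb_smul_assoc z a x⟩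

/-- A closed submodule of a Hilbert module is a Hilbert module. -/
noncomputable def closedSubmodule (X : HilbertModule A) (N : Submodule A X)
    (hN : IsClosed (N : Set X)) :
    HilbertModule A :=
  letI : CStarModule A N :=
    { inner := fun x y => inner A (x : X) (y : X)
      inner_add_right := by simp
      inner_self_nonneg := CStarModule.inner_self_nonneg
      inner_self := fun {x} => by rw [CStarModule.inner_self]; exact Submodule.coe_eq_zero
      inner_op_smul_right := by simp
      inner_smul_right_complex := by simp
      star_inner := fun x y => CStarModule.star_inner (x : X) (y : X)
      norm_eq_sqrt_norm_inner_self := fun x =>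
        CStarModule.norm_eq_sqrt_norm_inner_self (A := A) (x : X) }
  letI : CompleteSpace N := hN.completeSpace_coe
  ⟨N⟩

end HilbertModule

namespace BoundedHilbertModule

open HilbertModule

/-- The image of an idempotent is its set of fixed points, which is closed and so inherits the
structure of a Hilbert module. -/
instance : IsIdempotentComplete (BoundedHilbertModule A) where
  idempotents_split X p hp := by
    have hpp : ∀ x, clm p (clm p x) = clm p x := fun x =>
      congrArg (fun T : X ⟶ X => clm T x) hp
    let N : Submodule A X.toHilbertModule := LinearMap.eqLocus (linearMap p) LinearMap.id
    have hN : IsClosed (N : Set X.toHilbertModule) :=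
      isClosed_eq (clm p).continuous continuous_id
    let Y : BoundedHilbertModule A := ⟨closedSubmodule X.toHilbertModule N hN⟩
    let i : N →L[ℂ] X.toHilbertModule :=
      LinearMap.mkContinuous
        { toFun := fun x => (x : X.toHilbertModule)
          map_add' := fun _ _ => rfl
          map_smul' := fun _ _ => rfl } 1 (fun x => by simp)
    let e : X.toHilbertModule →L[ℂ] N :=
      LinearMap.mkContinuous
        { toFun := fun x => ⟨clm p x, hpp x⟩
          map_add' := fun x y => Subtype.ext (map_add (clm p) x y)
          map_smul' := fun z x => Subtype.ext (map_smul (clm p) z x) } ‖clm p‖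
        (fun x => (clm p).le_opNorm x)
    refine ⟨Y, homMk (X := Y) i fun _ _ => rfl,
      homMk (Y := Y) e fun a x => Subtype.ext (clm_map_smul p a x), ?_, ?_⟩
    · exact hom_ext fun x => Subtype.ext (x : N).2
    · exact hom_ext fun x => rfl

/-- The finitely generated Hilbert modules. -/
def IsFG (X : BoundedHilbertModule A) : Prop := Module.Finite A X.toHilbertModule

theorem IsFG.retract {X Y : BoundedHilbertModule A} (i : X ⟶ Y) (p : Y ⟶ X) (h : i ≫ p = 𝟙 X)
    (hY : IsFG Y) : IsFG X := by
  have : Module.Finite A Y.toHilbertModule := hY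
  exact Module.Finite.of_surjective (linearMap p) fun x =>
    ⟨clm i x, congrArg (fun T : X ⟶ X => clm T x) h⟩

theorem isAdditiveProperty_isFG : IsAdditiveProperty (IsFG (A := A)) where
  zero X hX := by
    have : Subsingleton X.toHilbertModule := ⟨fun x y => by
      have h := hX.eq_of_src (𝟙 X) 0
      have hx := congrArg (fun T : X ⟶ X => clm T x) h
      have hy := congrArg (fun T : X ⟶ X => clm T y) h
      exact hx.trans hy.symm⟩
    exact inferInstanceAs (Module.Finite A X.toHilbertModule)
  retract i p h hY := IsFG.retract i p h hY
  biprod {X Y} hX hY := by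
    have hX' : Module.Finite A X.toHilbertModule := hX
    have hY' : Module.Finite A Y.toHilbertModule := hY
    let f : X.toHilbertModule × Y.toHilbertModule →ₗ[A] (X ⊞ Y).toHilbertModule :=
      LinearMap.coprod (linearMap Limits.biprod.inl) (linearMap Limits.biprod.inr)
    refine Module.Finite.of_surjective f fun z =>
      ⟨(clm Limits.biprod.fst z, clm Limits.biprod.snd z), ?_⟩
    exact congrArg (fun T : X ⊞ Y ⟶ X ⊞ Y => clm T z) Limits.biprod.total

end BoundedHilbertModule

namespace HilbertModule

variable {X Y : HilbertModule A}

/-- The rank one operator `z ↦ ⟪x, z⟫ y`. -/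
noncomputable def rankOne (x : X) (y : Y) : X →L[ℂ] Y :=
  (hilbSMulCLM A y).comp (CStarModule.innerSL (A := A) x)

@[simp] theorem rankOne_apply (x : X) (y : Y) (z : X) :
    rankOne x y z = (inner A x z : A) • y := rfl

theorem inner_rankOne (x : X) (y : Y) (z : X) (w : Y) :
    inner A (rankOne x y z) w = inner A z (rankOne y x w) := by
  simp

theorem rankOne_mem (x : X) (y : Y) : rankOne x y ∈ adjointable X Y :=
  ⟨rankOne y x, inner_rankOne x y⟩

/-- If `T` is bounded below, then `T* T` is invertible. -/
theorem isUnit_adjoint_comp (T : X →L[ℂ] Y) (T' : Y →L[ℂ] X)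
    (hT : ∀ x y, inner A (T x) y = inner A x (T' y)) (K : ℝ) (hK : ∀ x, ‖x‖ ≤ K * ‖T x‖) :
    IsUnit (T'.comp T) := by
  -- The lower bound has to be uniform over the shifts by `t ≥ 0`. It is, because `⟪x, y⟫ = ⟪T x, T
  -- x⟫ + t ⟪x, x⟫` dominates `⟪T x, T x⟫`. The summand `1` only keeps the constant positive.
  refine hilb_isUnit_of_bddBelow _ (K ^ 2 + 1) (by positivity) fun t ht x => ?_
  set y := T'.comp T x + (t : ℂ) • x with hy
  have hxy : inner A x y = inner A (T x) (T x) + t • inner A x x := by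
    rw [hy, CStarModule.inner_add_right, CStarModule.inner_smul_right_complex, hT]
    simp
  have h1 : ‖T x‖ ^ 2 ≤ ‖x‖ * ‖y‖ := by
    refine le_trans ?_ (CStarModule.norm_inner_le X (A := A))
    rw [CStarModule.norm_sq_eq A, hxy]
    exact CStarAlgebra.norm_le_norm_of_nonneg_of_le CStarModule.inner_self_nonneg
      (le_add_of_nonneg_right (smul_nonneg ht CStarModule.inner_self_nonneg))
  rcases eq_or_ne x 0 with hx | hx
  · rw [hx, norm_zero]; positivity
  have h2 : ‖x‖ * ‖x‖ ≤ ‖x‖ * (K ^ 2 * ‖y‖) := by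
    calc ‖x‖ * ‖x‖ ≤ (K * ‖T x‖) * (K * ‖T x‖) :=
          mul_self_le_mul_self (norm_nonneg _) (hK x)
      _ = K ^ 2 * ‖T x‖ ^ 2 := by ring
      _ ≤ K ^ 2 * (‖x‖ * ‖y‖) := by gcongr
      _ = _ := by ring
  have h3 := le_of_mul_le_mul_left h2 (norm_pos_iff.mpr hx)
  linarith [norm_nonneg y]

/-- The C⋆-algebra as a Hilbert module over itself. -/
noncomputable abbrev self (A : Type u) [CStarAlgebra A] [PartialOrder A] [StarOrderedRing A] :
    HilbertModule A := ⟨A⟩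

/-- The operator `a ↦ a • x` from `A` to a Hilbert module. -/
noncomputable def smulHom (x : X) : self A ⟶ X :=
  ofMem (hilbSMulCLM A x) ⟨CStarModule.innerSL (A := A) x, fun a y => by
    change inner A ((a : A) • x) y = inner A x y * star (a : A)
    rw [CStarModule.inner_op_smul_left]⟩

theorem adjoint_smulHom (x y : X) : toCLM (adjoint (smulHom x)) y = (inner A x y : A) := by
  have h : adjoint (smulHom x) = ofMem (CStarModule.innerSL (A := A) x : X →L[ℂ] self A)
      ⟨hilbSMulCLM A x, fun y a => by
        change (a : A) * star (inner A x y : A) = inner A y ((a : A) • x)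
        rw [CStarModule.inner_op_smul_right, CStarModule.star_inner]⟩ :=
    adjoint_eq fun a y => by
      change inner A ((a : A) • x) y = inner A x y * star (a : A)
      rw [CStarModule.inner_op_smul_left]
  rw [h]; rfl

theorem inner_adjoint_left (T : X ⟶ Y) (x : X) (y : Y) :
    inner A (toCLM (adjoint T) y) x = inner A y (toCLM T x) := by
  rw [← CStarModule.star_inner, ← inner_adjoint, CStarModule.star_inner]

/-- A finitely generated Hilbert module has a finite frame. -/
theorem exists_frame (hX : Module.Finite A X) :
    ∃ (n : ℕ) (e f : Fin n → X), ∀ x, x = ∑ i, (inner A (f i) x : A) • e i := by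
  obtain ⟨n, f, hf⟩ := Module.Finite.exists_fin' A X
  set e : Fin n → X := fun i => f (Pi.single i 1) with he
  have hfe : ∀ a, f a = ∑ i, a i • e i := fun a => by
    conv_lhs => rw [← Finset.univ_sum_single a]
    rw [map_sum]
    refine Finset.sum_congr rfl fun i _ => ?_
    rw [he, ← map_smul, ← Pi.single_smul, smul_eq_mul, mul_one]
  let F : directSum (fun _ : Fin n => self A) ⟶ X :=
    ∑ i, projHom (fun _ : Fin n => self A) i ≫ smulHom (e i)
  have hF : ∀ a, toCLM F a = ∑ i, (show A from projCLM (fun _ : Fin n => self A) i a) • e i :=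
      fun a => by
    rw [toCLM_sum, sum_apply]; rfl
  have hFs : Function.Surjective (toCLM F) := fun x => by
    obtain ⟨a, ha⟩ := hf x
    refine ⟨(show directSum (fun _ : Fin n => self A) from a), (hF _).trans ?_⟩
    rw [← ha, hfe]; rfl
  -- The open mapping theorem for `F : Aⁿ → X` supplies the constant for which its adjoint `G` is
  -- bounded below.
  obtain ⟨C, hC, hCp⟩ := (toCLM F).exists_preimage_norm_le hFs
  let G : X ⟶ directSum (fun _ : Fin n => self A) :=
    ∑ i, adjoint (smulHom (e i)) ≫ inclHom (fun _ : Fin n => self A) i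
  have hFG : ∀ a x, inner A (toCLM F a) x = inner A a (toCLM G x) := fun a x => by
    rw [toCLM_sum, toCLM_sum, sum_apply, sum_apply, CStarModule.inner_sum_left,
      CStarModule.inner_sum_right]
    refine Finset.sum_congr rfl fun i _ => ?_
    rw [toCLM_comp, toCLM_comp, ContinuousLinearMap.comp_apply, ContinuousLinearMap.comp_apply,
      toCLM_projHom, toCLM_inclHom, ← inner_projCLM, inner_adjoint]
  have hGF : ∀ x a, inner A (toCLM G x) a = inner A x (toCLM F a) := fun x a => by
    rw [← CStarModule.star_inner, ← hFG, CStarModule.star_inner]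
  have hΘ : ∀ x, toCLM F (toCLM G x) = ∑ i, (inner A (e i) x : A) • e i := fun x => by
    rw [hF]
    refine Finset.sum_congr rfl fun i _ => ?_
    rw [← adjoint_smulHom]
    congr 1
    rw [toCLM_sum, sum_apply, map_sum]
    exact sum_projCLM_inclCLM (fun _ : Fin n => self A)
      (fun j => toCLM (adjoint (smulHom (e j))) x) i
  have hlow : ∀ x, ‖x‖ ≤ C * ‖toCLM G x‖ := by
    intro x
    rcases eq_or_ne x 0 with hx | hx
    · simp [hx]
    obtain ⟨a, ha, hna⟩ := hCp x
    have h1 : ‖x‖ * ‖x‖ ≤ ‖x‖ * (C * ‖toCLM G x‖) := by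
      calc ‖x‖ * ‖x‖ = ‖inner A (toCLM G x) a‖ := by
            rw [hGF, ha, ← sq, CStarModule.norm_sq_eq A]
        _ ≤ ‖toCLM G x‖ * ‖a‖ := CStarModule.norm_inner_le _
        _ ≤ ‖toCLM G x‖ * (C * ‖x‖) := by gcongr
        _ = _ := by ring
    exact le_of_mul_le_mul_left h1 (norm_pos_iff.mpr hx)
  obtain ⟨v, hv⟩ := isUnit_adjoint_comp (toCLM G) (toCLM F) hGF C hlow
  set w : X →L[ℂ] X := ((v⁻¹ : (X →L[ℂ] X)ˣ) : X →L[ℂ] X) with hw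
  have hr : ∀ x, toCLM F (toCLM G (w x)) = x := fun x => by
    change ((toCLM F).comp (toCLM G) * w) x = x
    rw [← hv, hw]; simp
  have hsa : ∀ x y, inner A (w x) y = inner A x (w y) := fun x y => by
    conv_lhs => rw [← hr y, ← hGF, ← hFG, hr]
  -- The inverse `w` of `Θ = ∑ i, ⟪e i, ·⟫ e i` is self-adjoint, so `x = Θ (w x)` turns into an
  -- expansion with dual vectors `w (e i)`.
  refine ⟨n, e, fun i => w (e i), fun x => ?_⟩
  conv_lhs => rw [← hr x, hΘ]
  simp only [hsa]

/-- Bounded module homomorphisms from a finitely generated Hilbert module are adjointable. -/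
theorem mem_adjointable_of_finite (hX : Module.Finite A X) {T : X →L[ℂ] Y}
    (hT : T ∈ bounded X Y) : T ∈ adjointable X Y := by
  obtain ⟨n, e, f, h⟩ := exists_frame hX
  -- Applying `T` to the frame expansion exhibits it as a finite sum of rank one operators, which
  -- are adjointable.
  have : T = ∑ i, rankOne (f i) (T (e i)) := by
    ext x
    conv_lhs => rw [h x, map_sum]
    rw [sum_apply]
    exact Finset.sum_congr rfl fun i _ => hT _ _
  rw [this]
  exact Submodule.sum_mem _ fun i _ => rankOne_mem _ _

end HilbertModule

end FinitelyGenerated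

/-! ### Fredholm complexes are finite up to homotopy -/

section FredholmFinite

set_option linter.unusedSectionVars false

universe v w

/-- A parametrix up to invertible operators yields one up to the identity. -/
theorem isHomotopyFinite_of_parametrix {V : Type w} [Category.{v} V] [Preadditive V]
    [Limits.HasBinaryBiproducts V] {P : V → Prop} (hP : IsAdditiveProperty P)
    (C : CochainComplex V ℤ) (g : ∀ i j, C.X i ⟶ C.X j) (u : ∀ i, C.X i ≅ C.X i)
    (h : ∀ i j k, i + 1 = j → j + 1 = k →
      FactorsThrough P (g j i ≫ C.d i j + C.d j k ≫ g k j - (u j).hom)) :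
    IsHomotopyFinite P C := by
  -- The parametrix is divided by `u`. The isomorphisms `u` need not form a chain map, but they are
  -- a chain map up to the errors `r` and `r'`, hence commute with the differential modulo `P`; so
  -- do their inverses.
  let η : ∀ i j, (ComplexShape.up ℤ).Rel j i → (C.X i ⟶ C.X j) :=
    fun i j _ => -(g i j ≫ (u j).inv)
  let φ : C ⟶ C := Homotopy.nullHomotopicMap' η
  refine ⟨𝟙 C + φ, ⟨Homotopy.equivSubZero.symm
    ((Homotopy.ofEq (by simp [φ])).trans (Homotopy.nullHomotopy' η))⟩, fun k => ?_⟩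
  obtain ⟨j, hjk⟩ : ∃ j, j + 1 = k := ⟨k - 1, by omega⟩
  obtain ⟨i, hij⟩ : ∃ i, i + 1 = j := ⟨j - 1, by omega⟩
  have hr := h i j k hij hjk
  have hr' := h j k (k + 1) hjk rfl
  set r := g j i ≫ C.d i j + C.d j k ≫ g k j - (u j).hom with hrdef
  set r' := g k j ≫ C.d j k + C.d k (k + 1) ≫ g (k + 1) k - (u k).hom with hrdef'
  have h₁ : C.d j k ≫ (u k).hom - (u j).hom ≫ C.d j k = r ≫ C.d j k - C.d j k ≫ r' := by
    simp only [hrdef, hrdef', Preadditive.sub_comp, Preadditive.comp_sub, Preadditive.add_comp,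
      Preadditive.comp_add, Category.assoc, C.d_comp_d, C.d_comp_d_assoc, Limits.comp_zero,
      Limits.zero_comp]
    abel
  have h₂ : (u j).inv ≫ C.d j k - C.d j k ≫ (u k).inv =
      (u j).inv ≫ (r ≫ C.d j k - C.d j k ≫ r') ≫ (u k).inv := by
    rw [← h₁]
    simp
  have h₃ : (𝟙 C + φ).f k = -(r' ≫ (u k).inv) -
      g k j ≫ ((u j).inv ≫ (r ≫ C.d j k - C.d j k ≫ r') ≫ (u k).inv) := by
    rw [← h₂, HomologicalComplex.add_f_apply, HomologicalComplex.id_f,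
      Homotopy.nullHomotopicMap'_f (show (ComplexShape.up ℤ).Rel j k from hjk)
        (show (ComplexShape.up ℤ).Rel k (k + 1) from rfl), hrdef']
    simp only [η, Preadditive.sub_comp, Preadditive.comp_sub, Preadditive.add_comp,
      Preadditive.comp_neg, Preadditive.neg_comp, Category.assoc, Iso.hom_inv_id]
    abel
  rw [h₃]
  refine .sub hP (hr'.comp_right _).neg (.comp_left (.comp_left (.comp_right ?_ _) _) _)
  exact .sub hP (hr.comp_right _) (hr'.comp_left _)

variable {A : Type u} [CStarAlgebra A] [PartialOrder A] [StarOrderedRing A]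

namespace HilbertModule

variable {X Y Z : HilbertModule A}

/-- By linearity and continuity, preservation of compactness need only be tested on rank one
operators. -/
theorem compacts_map_le {X' Y' : HilbertModule A} (f : (X →L[ℂ] Y) →L[ℂ] (X' →L[ℂ] Y'))
    (hf : ∀ (x : X) (y : Y), f (rankOne x y) ∈ compacts X' Y') {K : X →L[ℂ] Y}
    (hK : K ∈ compacts X Y) : f K ∈ compacts X' Y' := by
  have h : compacts X Y ≤ (compacts X' Y').comap (f : (X →L[ℂ] Y) →ₗ[ℂ] (X' →L[ℂ] Y')) := by
    refine Submodule.topologicalClosure_minimal _ (Submodule.span_le.mpr ?_) ?_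
    · rintro T ⟨x, y, hT⟩
      obtain rfl : T = rankOne x y := by ext z; exact hT z
      exact hf x y
    · exact (Submodule.isClosed_topologicalClosure _).preimage f.continuous
  exact h hK

theorem rankOne_mem_compacts (x : X) (y : Y) : rankOne x y ∈ compacts X Y :=
  Submodule.le_topologicalClosure _ (Submodule.subset_span ⟨x, y, fun _ => rfl⟩)

namespace IsCompactOp

theorem comp_right {K : X ⟶ Y} (hK : IsCompactOp K) (T : Y ⟶ Z) : IsCompactOp (K ≫ T) :=
  compacts_map_le (ContinuousLinearMap.compL ℂ X Y Z (toCLM T)) (fun x y => by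
    have : ContinuousLinearMap.compL ℂ X Y Z (toCLM T) (rankOne x y) = rankOne x (toCLM T y) := by
      ext z
      exact adjointable_le_bounded Y Z (toCLM_mem T) _ _
    rw [this]
    exact rankOne_mem_compacts _ _) hK

/-- Here adjointability is essential: `⟪x, T z⟫ = ⟪T* x, z⟫` is what makes the composite of a rank
one operator with `T` of rank one again. -/
theorem comp_left {K : Y ⟶ Z} (hK : IsCompactOp K) (T : X ⟶ Y) : IsCompactOp (T ≫ K) :=
  compacts_map_le ((ContinuousLinearMap.compL ℂ X Y Z).flip (toCLM T)) (fun x y => by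
    have : (ContinuousLinearMap.compL ℂ X Y Z).flip (toCLM T) (rankOne x y) =
        rankOne (toCLM (adjoint T) x) y := by
      ext z
      change (inner A x (toCLM T z) : A) • y = (inner A (toCLM (adjoint T) x) z : A) • y
      rw [inner_adjoint_left]
    rw [this]
    exact rankOne_mem_compacts _ _) hK

theorem add {S T : X ⟶ Y} (hS : IsCompactOp S) (hT : IsCompactOp T) : IsCompactOp (S + T) :=
  Submodule.add_mem _ hS hT

theorem sub {S T : X ⟶ Y} (hS : IsCompactOp S) (hT : IsCompactOp T) : IsCompactOp (S - T) :=
  Submodule.sub_mem _ hS hT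

theorem zero : IsCompactOp (0 : X ⟶ Y) := Submodule.zero_mem _

end IsCompactOp

end HilbertModule

namespace BoundedHilbertModule

open HilbertModule

variable {X Y : HilbertModule A}

/-- A bounded module homomorphism as a morphism of `𝓑_A` between images of objects of `𝓛_A`. -/
def boundedHom (T : X →L[ℂ] Y) (hT : T ∈ bounded X Y) :
    (ofAdjointable A).obj X ⟶ (ofAdjointable A).obj Y :=
  Subtype.mk T hT

/-- Operators of finite rank factor through a finitely generated module. -/
theorem exists_factorsThrough_of_mem_span {R : X →L[ℂ] Y}
    (hR : R ∈ Submodule.span ℂ {T : X →L[ℂ] Y |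
      ∃ (x : X) (y : Y), ∀ z : X, T z = (inner A x z : A) • y}) :
    ∃ h : R ∈ bounded X Y, FactorsThrough IsFG (boundedHom R h) := by
  induction hR using Submodule.span_induction with
  | mem T hT =>
    obtain ⟨x, y, hT⟩ := hT
    obtain rfl : T = rankOne x y := by ext z; exact hT z
    refine ⟨adjointable_le_bounded X Y (rankOne_mem x y), (ofAdjointable A).obj (self A),
      inferInstanceAs (Module.Finite A A), (ofAdjointable A).map (adjoint (smulHom x)),
      (ofAdjointable A).map (smulHom y), hom_ext fun z => ?_⟩
    exact congrArg (fun a : A => a • y) (adjoint_smulHom x z).symm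
  | zero =>
    obtain ⟨Z, hZ⟩ := Limits.HasZeroObject.zero (C := BoundedHilbertModule A)
    exact ⟨Submodule.zero_mem _, Z, isAdditiveProperty_isFG.zero _ hZ, 0, 0, by
      rw [Limits.comp_zero]; rfl⟩
  | add S T _ _ hS hT =>
    obtain ⟨h, hr⟩ := hS
    obtain ⟨h', hr'⟩ := hT
    exact ⟨Submodule.add_mem _ h h', .add isAdditiveProperty_isFG hr hr'⟩
  | smul z T _ hT =>
    obtain ⟨h, hr⟩ := hT
    exact ⟨Submodule.smul_mem _ z h, hr.comp_right ((ofAdjointable A).map (z • 𝟙 Y))⟩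

/-- A bijective bounded module homomorphism whose inverse is bounded is an isomorphism. -/
def isoMk {X Y : BoundedHilbertModule A} (T : X ⟶ Y) (S : Y.toHilbertModule →L[ℂ] X.toHilbertModule)
    (h₁ : ∀ x, S (clm T x) = x) (h₂ : ∀ y, clm T (S y) = y) : X ≅ Y where
  hom := T
  inv := homMk S fun a y => by
    conv_lhs => rw [← h₂ y, ← clm_map_smul, h₁]
  hom_inv_id := hom_ext h₁
  inv_hom_id := hom_ext h₂

theorem exists_iso_of_isUnit {X : BoundedHilbertModule A} (T : X ⟶ X) (hT : IsUnit (clm T)) :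
    ∃ u : X ≅ X, u.hom = T := by
  obtain ⟨v, hv⟩ := hT
  refine ⟨isoMk T (v⁻¹ : (X.toHilbertModule →L[ℂ] X.toHilbertModule)ˣ).1
    (fun x => ?_) (fun x => ?_), rfl⟩
  · rw [← hv, ← mul_apply_eq_comp]; simp
  · rw [← hv, ← mul_apply_eq_comp]; simp

/-- An operator that is the identity up to a compact operator is an isomorphism up to an operator
that factors through a finitely generated module. -/
theorem exists_iso_of_isCompactOp {T : X ⟶ X} (hT : IsCompactOp (T - 𝟙 X)) :
    ∃ u : (ofAdjointable A).obj X ≅ (ofAdjointable A).obj X,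
      FactorsThrough IsFG ((ofAdjointable A).map T - u.hom) := by
  -- With `R` of finite rank at distance less than `1` from `T - 𝟙`, the operator `T - R` is within
  -- distance `1` of the identity, so it is invertible by the Neumann series.
  obtain ⟨R, hR, hTR⟩ := Metric.mem_closure_iff.mp hT 1 one_pos
  obtain ⟨h, hr⟩ := exists_factorsThrough_of_mem_span hR
  obtain ⟨u, hu⟩ := exists_iso_of_isUnit ((ofAdjointable A).map T - boundedHom R h) (by
    have h1 : (toCLM T - R : X →L[ℂ] X) = 1 - -(toCLM (T - 𝟙 X) - R) := by
      rw [toCLM_sub, toCLM_id]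
      change _ = ContinuousLinearMap.id ℂ X - _
      abel
    have h2 : IsUnit (toCLM T - R : X →L[ℂ] X) := by
      rw [h1]
      refine (Units.oneSub _ ?_).isUnit
      rwa [norm_neg, ← dist_eq_norm]
    exact h2)
  exact ⟨u, by rw [hu]; simpa using hr⟩

/-- A Fredholm complex is homotopy finite. -/
theorem isHomotopyFinite_of_isFredholmComplex {E : CochainComplex (HilbertModule A) ℤ}
    (hE : IsFredholmComplex E) : IsHomotopyFinite IsFG (toBounded E) := by
  obtain ⟨g, hg⟩ := hE
  have hu := fun i => exists_iso_of_isCompactOp (hg i)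
  choose u hu using hu
  refine isHomotopyFinite_of_parametrix isAdditiveProperty_isFG (toBounded E)
    (fun i j => (ofAdjointable A).map (g i j)) u ?_
  rintro i j k rfl rfl
  have h := hu (i + 1)
  -- The index `i + 1 - 1` occurs in types, so it is made a variable before being identified with
  -- `i`.
  obtain ⟨i', hi'⟩ : ∃ i', i' = i + 1 - 1 := ⟨_, rfl⟩
  rw [← hi'] at h
  obtain rfl : i' = i := by omega
  rwa [Functor.map_add, Functor.map_comp, Functor.map_comp] at h

theorem exists_hasEulerChar {C : CochainComplex (BoundedHilbertModule A) ℤ}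
    (hC : IsHomotopyFinite IsFG C) (s : Finset ℤ) (hs : ∀ i ∉ s, Limits.IsZero (C.X i)) :
    ∃ x, HasEulerChar C x := by
  obtain ⟨m, hm⟩ := s.bddBelow
  obtain ⟨n, hn⟩ := s.bddAbove
  obtain ⟨F, e, hF, hz⟩ := hC.exists_homotopyEquiv isAdditiveProperty_isFG m n fun i hi =>
    hs i fun his => by
      have := hm his
      have := hn his
      omega
  exact ⟨_, F, Finset.Icc (m - 1) n, hF, fun i hi => hz i (by rw [Finset.mem_Icc] at hi; omega),
    e, rfl⟩

end BoundedHilbertModule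

end FredholmFinite

/-! ### Complexes whose operator `S` is Fredholm -/

section Calkin

set_option linter.unusedSectionVars false

universe v w

/-! ### Inclusions and identity matrices for blocks -/

section Blocks

variable {V : Type w} [Category.{v} V] [Preadditive V] {J : Type*} [DecidableEq J]
  {X Y Z : J → V} {s t r : Finset J} (b : Limits.Bicone fun i : s => X i)
  (b' : Limits.Bicone fun i : t => Y i) (b'' : Limits.Bicone fun i : r => Z i)

theorem ι_blockHom (M : ∀ i j, X i ⟶ Y j) (i : s) :
    b.ι i ≫ blockHom b b' M = ∑ j : t, M i j ≫ b'.ι j := by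
  simp only [blockHom, Preadditive.comp_sum]
  rw [Finset.sum_eq_single i]
  · simp only [← Category.assoc, bicone_ι_π, deltaHom_self, Category.id_comp]
  · intro k _ hk
    refine Finset.sum_eq_zero fun j _ => ?_
    rw [← Category.assoc, bicone_ι_π, deltaHom_of_ne _ (fun h => hk (Subtype.ext h.symm))]
    simp
  · simp

theorem sum_delta_comp (s : Finset J) (M : ∀ i j, X i ⟶ Y j) (i k : J) (h : i ∉ s → M i k = 0) :
    ∑ j ∈ s, deltaHom X i j ≫ M j k = M i k := by
  by_cases hi : i ∈ s
  · rw [Finset.sum_eq_single_of_mem i hi, deltaHom_self, Category.id_comp]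
    intro j _ hj
    rw [deltaHom_of_ne _ hj.symm, Limits.zero_comp]
  · rw [h hi]
    refine Finset.sum_eq_zero fun j hj => ?_
    rw [deltaHom_of_ne _ (by rintro rfl; exact hi hj), Limits.zero_comp]

theorem sum_comp_delta (s : Finset J) (M : ∀ i j, X i ⟶ Y j) (i k : J) (h : k ∉ s → M i k = 0) :
    ∑ j ∈ s, M i j ≫ deltaHom Y j k = M i k := by
  by_cases hk : k ∈ s
  · rw [Finset.sum_eq_single_of_mem k hk, deltaHom_self, Category.comp_id]
    intro j _ hj
    rw [deltaHom_of_ne _ hj, Limits.comp_zero]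
  · rw [h hk]
    refine Finset.sum_eq_zero fun j hj => ?_
    rw [deltaHom_of_ne _ (by rintro rfl; exact hk hj), Limits.comp_zero]

end Blocks

variable {A : Type u} [CStarAlgebra A] [PartialOrder A] [StarOrderedRing A]

namespace HilbertModule

variable {X Y Z : HilbertModule A}

/-- Equality of adjointable operators up to compact operators. -/
def CompactEq (S T : X ⟶ Y) : Prop := IsCompactOp (S - T)

namespace CompactEq

theorem of_eq {S T : X ⟶ Y} (h : S = T) : CompactEq S T := by
  rw [CompactEq, h, sub_self]
  exact IsCompactOp.zero

theorem symm {S T : X ⟶ Y} (h : CompactEq S T) : CompactEq T S := by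
  have := IsCompactOp.zero.sub h
  rwa [zero_sub, neg_sub] at this

theorem trans {R S T : X ⟶ Y} (h : CompactEq R S) (h' : CompactEq S T) : CompactEq R T := by
  have := IsCompactOp.add h h'
  rwa [sub_add_sub_cancel] at this

theorem add {S T S' T' : X ⟶ Y} (h : CompactEq S T) (h' : CompactEq S' T') :
    CompactEq (S + S') (T + T') := by
  have := IsCompactOp.add h h'
  rwa [sub_add_sub_comm] at this

theorem comp_left {S T : Y ⟶ Z} (h : CompactEq S T) (R : X ⟶ Y) : CompactEq (R ≫ S) (R ≫ T) := by
  have := IsCompactOp.comp_left h R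
  rwa [Preadditive.comp_sub] at this

theorem comp_right {S T : X ⟶ Y} (h : CompactEq S T) (R : Y ⟶ Z) :
    CompactEq (S ≫ R) (T ≫ R) := by
  have := IsCompactOp.comp_right h R
  rwa [Preadditive.sub_comp] at this

end CompactEq

end HilbertModule

open HilbertModule

variable (E : CochainComplex (HilbertModule A) ℤ)

/-- The sum of the modules `Eⁱ` with `i ∈ s` as a bicone. -/
noncomputable def sumOverBicone (s : Finset ℤ) : Limits.Bicone fun i : s => E.X i :=
  directSumBicone fun i : s => E.X i

theorem isDirectSum_sumOverBicone (s : Finset ℤ) : IsDirectSum (sumOverBicone E s) :=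
  directSumBicone_total _

theorem signatureBlock_eq (s t : Finset ℤ) :
    signatureBlock E s t =
      blockHom (sumOverBicone E s) (sumOverBicone E t) (signatureComponent E) :=
  matrixHom_eq_sum _

theorem signatureComponent_eq_zero {i j : ℤ} (h₁ : i + 1 ≠ j) (h₂ : j + 1 ≠ i) :
    signatureComponent E i j = 0 := by
  rw [signatureComponent, E.shape i j h₁, E.shape j i h₂, adjoint_zero, sub_zero, smul_zero]

/-- The Laplace operator in one degree. -/
noncomputable def laplacian (i : ℤ) : E.X i ⟶ E.X i :=
  adjoint (E.d (i - 1) i) ≫ E.d (i - 1) i + E.d i (i + 1) ≫ adjoint (E.d i (i + 1))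

theorem laplacian_eq {i j k : ℤ} (hij : i + 1 = j) (hjk : j + 1 = k) :
    laplacian E j = adjoint (E.d i j) ≫ E.d i j + E.d j k ≫ adjoint (E.d j k) := by
  obtain rfl : i = j - 1 := by omega
  subst hjk
  rfl

/-- Both sides reduce to `d ≫ d* ≫ d`, the other terms containing `d ≫ d = 0`. -/
theorem d_laplacian {i j : ℤ} (hij : i + 1 = j) :
    E.d i j ≫ laplacian E j = laplacian E i ≫ E.d i j := by
  rw [laplacian_eq E hij rfl, laplacian_eq E (sub_add_cancel i 1) hij]
  simp

/-- The scalar `(-i)² = -1` cancels the sign of the mixed terms, and `d ≫ d` and `d* ≫ d*` vanish.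
-/
theorem signatureComponent_comp (i k j : ℤ) :
    signatureComponent E i k ≫ signatureComponent E k j =
      E.d i k ≫ adjoint (E.d j k) + adjoint (E.d k i) ≫ E.d k j := by
  have h : adjoint (E.d k i) ≫ adjoint (E.d j k) = 0 := by
    rw [← adjoint_comp, E.d_comp_d, adjoint_zero]
  have hI : ∀ T : E.X i ⟶ E.X j, Complex.I • Complex.I • T = -T := fun T => by
    rw [← mul_smul, Complex.I_mul_I, neg_one_smul]
  simp only [signatureComponent, Linear.smul_comp, Linear.comp_smul,
    Preadditive.sub_comp, Preadditive.comp_sub, E.d_comp_d, h]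
  simp only [neg_smul, smul_neg, smul_sub, smul_zero, hI]
  abel

variable {E} {s : Finset ℤ}

/-- In matrix form, `S²` is diagonal with the Laplacians as entries. -/
theorem sum_signatureComponent (hs : ∀ i ∉ s, Limits.IsZero (E.X i)) (i j : ℤ) :
    ∑ k ∈ s, signatureComponent E i k ≫ signatureComponent E k j =
      laplacian E i ≫ deltaHom E.X i j := by
  simp only [signatureComponent_comp, Finset.sum_add_distrib]
  rw [sum_comp_eq_single (fun k => E.d i k) (fun k => adjoint (E.d j k)) (i + 1)
      (fun k hk => Or.inl (E.shape _ _ fun h => hk h.symm)) (hs _),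
    sum_comp_eq_single (fun k => adjoint (E.d k i)) (fun k => E.d k j) (i - 1)
      (fun k hk => Or.inl (by
        rw [E.shape _ _ fun h => hk (eq_sub_of_add_eq h), adjoint_zero])) (hs _)]
  by_cases hij : i = j
  · subst hij
    rw [deltaHom_self, Category.comp_id, laplacian, add_comm]
  · rw [deltaHom_of_ne _ hij, E.shape j (i + 1) (fun h => hij (add_right_cancel (b := 1) h).symm),
      E.shape (i - 1) j (fun h => hij ((sub_add_cancel i 1).symm.trans h))]
    simp

theorem exists_parametrix_laplacian (hs : ∀ i ∉ s, Limits.IsZero (E.X i))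
    (hS : IsFredholm (signatureOp E s)) (i : ℤ) :
    ∃ P : E.X i ⟶ E.X i, CompactEq (laplacian E i ≫ P) (𝟙 _) ∧
      CompactEq (P ≫ laplacian E i) (𝟙 _) := by
  by_cases hi : i ∈ s
  · obtain ⟨G, hG₁, hG₂⟩ := hS
    set S := signatureOp E s with hSdef
    set b := sumOverBicone E s
    have hSS : S ≫ S = blockHom b b fun i j => laplacian E i ≫ deltaHom E.X i j := by
      rw [hSdef, signatureOp, signatureBlock_eq]
      refine (blockHom_comp _ _ _ _ _).trans ?_
      exact blockHom_congr _ _ fun i _ j _ => sum_signatureComponent hs i j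
    let ι : E.X i ⟶ sumOver E s := b.ι ⟨i, hi⟩
    let π : sumOver E s ⟶ E.X i := b.π ⟨i, hi⟩
    have hιπ : ι ≫ π = 𝟙 _ := (bicone_ι_π b _ _).trans (deltaHom_self E.X i)
    have h₁ : ι ≫ S ≫ S = laplacian E i ≫ ι := by
      rw [hSS]
      refine (ι_blockHom b b _ _).trans ?_
      rw [Finset.sum_eq_single ⟨i, hi⟩, deltaHom_self, Category.comp_id]
      · rfl
      · intro j _ hj
        rw [deltaHom_of_ne _ (fun h => hj (Subtype.ext h.symm))]
        simp
      · simp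
    have h₂ : S ≫ S ≫ π = π ≫ laplacian E i := by
      rw [← Category.assoc, hSS]
      refine (blockHom_π b b _ _).trans ?_
      rw [Finset.sum_eq_single ⟨i, hi⟩, deltaHom_self, Category.comp_id]
      · rfl
      · intro j _ hj
        rw [deltaHom_of_ne _ (fun h => hj (Subtype.ext h))]
        simp
      · simp
    have hG₁' : CompactEq (S ≫ S ≫ G ≫ G) (𝟙 _) := by
      have := (CompactEq.comp_right hG₁ G).comp_left S
      simp only [Category.assoc, Category.id_comp] at this
      exact this.trans hG₁
    have hG₂' : CompactEq (G ≫ G ≫ S ≫ S) (𝟙 _) := by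
      have := (CompactEq.comp_right hG₂ S).comp_left G
      simp only [Category.assoc, Category.id_comp] at this
      exact this.trans hG₂
    -- As `S ≫ S` is diagonal, it intertwines `ι` and `π` with the Laplacian, so the compression of
    -- its parametrix `G ≫ G` is a parametrix of the Laplacian.
    refine ⟨ι ≫ G ≫ G ≫ π, ?_, ?_⟩
    · rw [← Category.assoc, ← h₁]
      have := (hG₁'.comp_right π).comp_left ι
      simpa [hιπ] using this
    · have := (hG₂'.comp_right π).comp_left ι
      simpa [hιπ, h₂] using this
  · exact ⟨0, .of_eq ((hs i hi).eq_of_src _ _), .of_eq ((hs i hi).eq_of_src _ _)⟩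

/-- The contraction of Hodge theory, Green operator times `d*`, works modulo compacts. -/
theorem isFredholmComplex_of_isFredholm (hs : ∀ i ∉ s, Limits.IsZero (E.X i))
    (hS : IsFredholm (signatureOp E s)) : IsFredholmComplex E := by
  choose P hP₁ hP₂ using exists_parametrix_laplacian hs hS
  refine ⟨fun i j => P i ≫ adjoint (E.d j i), fun i => ?_⟩
  -- Modulo compacts, `d ≫ P = P ≫ Δ ≫ d ≫ P = P ≫ d ≫ Δ ≫ P = P ≫ d`.
  have hd : CompactEq (E.d i (i + 1) ≫ P (i + 1)) (P i ≫ E.d i (i + 1)) := by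
    have h₁ := (hP₂ i).comp_right (E.d i (i + 1) ≫ P (i + 1))
    have h₂ := (hP₁ (i + 1)).comp_left (P i ≫ E.d i (i + 1))
    simp only [Category.assoc, Category.id_comp, Category.comp_id] at h₁ h₂
    rw [← reassoc_of% (d_laplacian E (rfl : i + 1 = i + 1))] at h₁
    exact h₁.symm.trans h₂
  have h := (CompactEq.of_eq (rfl : P i ≫ adjoint (E.d (i - 1) i) ≫ E.d (i - 1) i = _)).add
    (hd.comp_right (adjoint (E.d i (i + 1))))
  simp only [Category.assoc] at h ⊢
  refine h.trans ?_
  rw [← Preadditive.comp_add]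
  exact hP₂ i

theorem isFredholm_signatureEven (hS : IsFredholm (signatureOp E s)) :
    IsFredholm (signatureEven E s) := by
  obtain ⟨G, hG₁, hG₂⟩ := hS
  set e : Finset ℤ := {i ∈ s | Even i} with he
  set o : Finset ℤ := {i ∈ s | Odd i} with ho
  let J (t : Finset ℤ) : sumOver E t ⟶ sumOver E s :=
    blockHom (sumOverBicone E t) (sumOverBicone E s) (deltaHom E.X)
  let Q (t : Finset ℤ) : sumOver E s ⟶ sumOver E t :=
    blockHom (sumOverBicone E s) (sumOverBicone E t) (deltaHom E.X)
  have hJQ : ∀ t ⊆ s, J t ≫ Q t = 𝟙 (sumOver E t) := fun t ht => by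
    refine (blockHom_comp _ _ _ _ _).trans ?_
    refine Eq.trans ?_ (blockHom_delta _ (isDirectSum_sumOverBicone E t))
    exact blockHom_congr _ _ fun i hi j _ => sum_delta_comp _ _ _ _ fun h => absurd (ht hi) h
  have hee : ∀ i j : ℤ, Even i → Even j → signatureComponent E i j = 0 := fun i j hi hj => by
    refine signatureComponent_eq_zero E ?_ ?_ <;> rintro rfl <;> grind
  have hoo : ∀ i j : ℤ, Odd i → Odd j → signatureComponent E i j = 0 := fun i j hi hj => by
    refine signatureComponent_eq_zero E ?_ ?_ <;> rintro rfl <;> grind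
  have hJ : J e ≫ signatureOp E s = signatureEven E s ≫ J o := by
    rw [signatureOp, signatureEven, signatureBlock_eq, signatureBlock_eq]
    refine (blockHom_comp _ _ _ _ _).trans (Eq.trans ?_ (blockHom_comp _ _ _ _ _).symm)
    refine blockHom_congr _ _ fun i hi j hj => ?_
    rw [Finset.mem_filter] at hi
    rw [sum_delta_comp _ _ _ _ fun h => absurd hi.1 h, sum_comp_delta]
    intro h
    refine hee i j hi.2 (Int.not_odd_iff_even.mp fun hj' => h ?_)
    exact Finset.mem_filter.mpr ⟨hj, hj'⟩
  have hQ : Q e ≫ signatureEven E s = signatureOp E s ≫ Q o := by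
    rw [signatureOp, signatureEven, signatureBlock_eq, signatureBlock_eq]
    refine (blockHom_comp _ _ _ _ _).trans (Eq.trans ?_ (blockHom_comp _ _ _ _ _).symm)
    refine blockHom_congr _ _ fun i hi j hj => ?_
    rw [Finset.mem_filter] at hj
    rw [sum_comp_delta _ _ _ _ fun h => absurd hj.1 h, sum_delta_comp]
    intro h
    refine hoo i j (Int.not_even_iff_odd.mp fun hi' => h ?_) hj.2
    exact Finset.mem_filter.mpr ⟨hi, hi'⟩
  -- No parity condition on `G` is needed: by `hJ` and `hQ` the composites with `S^even` become
  -- compressions of `S ≫ G` and `G ≫ S`.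
  refine ⟨J o ≫ G ≫ Q e, ?_, ?_⟩
  · have := (CompactEq.comp_right hG₁ (Q e)).comp_left (J e)
    simp only [Category.assoc, Category.id_comp, hJQ e (Finset.filter_subset _ _)] at this
    rwa [reassoc_of% hJ] at this
  · have := (CompactEq.comp_right hG₂ (Q o)).comp_left (J o)
    simp only [Category.assoc, Category.id_comp, hJQ o (Finset.filter_subset _ _)] at this
    rw [← hQ] at this
    simp only [Category.assoc] at this ⊢
    exact this

end Calkin

/-! ### Two by two matrices and folded mapping cones -/

section TwoByTwo

set_option linter.unusedSectionVars false

open Limits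

universe v w

variable {V : Type w} [Category.{v} V] [Preadditive V]
  {P P' P'' X X' X'' : V} (b : BinaryBicone P X) (b' : BinaryBicone P' X')
  (b'' : BinaryBicone P'' X'')

/-- The morphism of direct sums of two objects with the given components. -/
def squareHom (α : P ⟶ P') (β : P ⟶ X') (γ : X ⟶ P') (δ : X ⟶ X') : b.pt ⟶ b'.pt :=
  b.fst ≫ α ≫ b'.inl + b.fst ≫ β ≫ b'.inr + b.snd ≫ γ ≫ b'.inl + b.snd ≫ δ ≫ b'.inr

theorem squareHom_comp (α : P ⟶ P') (β : P ⟶ X') (γ : X ⟶ P') (δ : X ⟶ X')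
    (α' : P' ⟶ P'') (β' : P' ⟶ X'') (γ' : X' ⟶ P'') (δ' : X' ⟶ X'') :
    squareHom b b' α β γ δ ≫ squareHom b' b'' α' β' γ' δ' =
      squareHom b b'' (α ≫ α' + β ≫ γ') (α ≫ β' + β ≫ δ') (γ ≫ α' + δ ≫ γ')
        (γ ≫ β' + δ ≫ δ') := by
  simp only [squareHom, Preadditive.add_comp, Preadditive.comp_add, Category.assoc,
    BinaryBicone.inl_fst_assoc, BinaryBicone.inl_snd_assoc, BinaryBicone.inr_fst_assoc,
    BinaryBicone.inr_snd_assoc, zero_comp, comp_zero, add_zero, zero_add]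
  abel

theorem squareHom_add (α α' : P ⟶ P') (β β' : P ⟶ X') (γ γ' : X ⟶ P') (δ δ' : X ⟶ X') :
    squareHom b b' α β γ δ + squareHom b b' α' β' γ' δ' =
      squareHom b b' (α + α') (β + β') (γ + γ') (δ + δ') := by
  simp only [squareHom, Preadditive.add_comp, Preadditive.comp_add]
  abel

theorem inr_squareHom_snd (α : P ⟶ P') (β : P ⟶ X') (γ : X ⟶ P') (δ : X ⟶ X') :
    b.inr ≫ squareHom b b' α β γ δ ≫ b'.snd = δ := by
  simp [squareHom]

theorem squareHom_zero : squareHom b b' 0 0 0 0 = 0 := by simp [squareHom]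

/-- The bicone `b` is a direct sum. -/
def IsBinarySum (b : BinaryBicone P X) : Prop := b.fst ≫ b.inl + b.snd ≫ b.inr = 𝟙 b.pt

variable {b} in
theorem IsBinarySum.squareHom_id (hb : IsBinarySum b) : squareHom b b (𝟙 _) 0 0 (𝟙 _) = 𝟙 _ := by
  rw [← show _ = _ from hb]
  simp [squareHom]

theorem map_squareHom {W : Type*} [Category W] [Preadditive W] (G : V ⥤ W) [G.Additive]
    (α : P ⟶ P') (β : P ⟶ X') (γ : X ⟶ P') (δ : X ⟶ X') :
    G.map (squareHom b b' α β γ δ) =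
      squareHom (G.mapBinaryBicone b) (G.mapBinaryBicone b') (G.map α) (G.map β) (G.map γ)
        (G.map δ) := by
  simp only [squareHom, G.map_add, G.map_comp]
  rfl

theorem IsBinarySum.map {W : Type*} [Category W] [Preadditive W] (G : V ⥤ W) [G.Additive]
    {b : BinaryBicone P X} (hb : IsBinarySum b) : IsBinarySum (G.mapBinaryBicone b) := by
  have := congrArg G.map hb
  rw [G.map_add, G.map_comp, G.map_comp, G.map_id] at this
  exact this

/-- An isomorphism of direct sums gives a homotopy equivalence between the complex formed by one
component and the complex formed by the complementary component of the inverse. -/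
noncomputable def cornerHomotopyEquiv [HasZeroObject V] {b : BinaryBicone P X}
    {b' : BinaryBicone P' X'} (hb : IsBinarySum b) (hb' : IsBinarySum b') (f : b.pt ≅ b'.pt)
    {i j : ℤ} (hij : (ComplexShape.up ℤ).Rel i j) :
    HomotopyEquiv (HomologicalComplex.double (b.inr ≫ f.hom ≫ b'.snd) hij)
      (HomologicalComplex.double (b'.inl ≫ f.inv ≫ b.fst) hij) := by
  -- Inserting the decomposed identity of the direct sum between the two isomorphisms yields each of
  -- the six matrix identities required.
  have h : ∀ {Y Z : V} (g : Y ⟶ b.pt) (k : b.pt ⟶ Z),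
      (g ≫ b.snd) ≫ b.inr ≫ k + (g ≫ b.fst) ≫ b.inl ≫ k = g ≫ k := fun g k => by
    have := congrArg (fun l => g ≫ l ≫ k) hb
    simpa [add_comm] using this
  have h' : ∀ {Y Z : V} (g : Y ⟶ b'.pt) (k : b'.pt ⟶ Z),
      (g ≫ b'.snd) ≫ b'.inr ≫ k + (g ≫ b'.fst) ≫ b'.inl ≫ k = g ≫ k := fun g k => by
    have := congrArg (fun l => g ≫ l ≫ k) hb'
    simpa [add_comm] using this
  refine doubleHomotopyEquiv (b := b.inl ≫ f.hom ≫ b'.snd) (a := b.inr ≫ f.hom ≫ b'.fst)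
    (c := b.inl ≫ f.hom ≫ b'.fst) (T' := b'.inr ≫ f.inv ≫ b.snd) (a' := b'.inr ≫ f.inv ≫ b.fst)
    (b' := b'.inl ≫ f.inv ≫ b.snd) ?_ ?_ ?_ ?_ ?_ ?_ hij
  · simpa using h' (b.inr ≫ f.hom) (f.inv ≫ b.fst)
  · simpa using h (b'.inl ≫ f.inv) (f.hom ≫ b'.snd)
  · simpa using h' (b.inr ≫ f.hom) (f.inv ≫ b.snd)
  · simpa using h (b'.inr ≫ f.inv) (f.hom ≫ b'.snd)
  · simpa using h (b'.inl ≫ f.inv) (f.hom ≫ b'.fst)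
  · simpa using h' (b.inl ≫ f.hom) (f.inv ≫ b.fst)

/-- A contraction up to a nilpotent error can be corrected to a contraction. -/
theorem exists_contraction {X Y : V} {D : X ⟶ Y} {D' : Y ⟶ X} (hD : D ≫ D' = 0)
    (hD' : D' ≫ D = 0) {H : X ⟶ Y} {H' : Y ⟶ X} {N : X ⟶ X} {N' : Y ⟶ Y}
    (hN : N ≫ N = 0) (hN' : N' ≫ N' = 0)
    (hX : D ≫ H' + H ≫ D' = 𝟙 X + N) (hY : D' ≫ H + H' ≫ D = 𝟙 Y + N') :
    ∃ (K : X ⟶ Y) (K' : Y ⟶ X), D ≫ K' + K ≫ D' = 𝟙 X ∧ D' ≫ K + K' ≫ D = 𝟙 Y := by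
  -- The left side of `hX`, `hY` is a chain map, so the errors commute with the differentials.
  have h₁ : N' ≫ D' = D' ≫ N := by
    have e₁ := congrArg (fun l => l ≫ D') hY
    have e₂ := congrArg (fun l => D' ≫ l) hX
    simp only [Preadditive.add_comp, Preadditive.comp_add, Category.assoc, hD, reassoc_of% hD',
      comp_zero, zero_comp, add_zero, zero_add, Category.id_comp, Category.comp_id] at e₁ e₂
    exact add_left_cancel (e₁.symm.trans e₂)
  have h₂ : N ≫ D = D ≫ N' := by
    have e₁ := congrArg (fun l => l ≫ D) hX
    have e₂ := congrArg (fun l => D ≫ l) hY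
    simp only [Preadditive.add_comp, Preadditive.comp_add, Category.assoc, hD', reassoc_of% hD,
      comp_zero, zero_comp, add_zero, zero_add, Category.id_comp, Category.comp_id] at e₁ e₂
    exact add_left_cancel (e₁.symm.trans e₂)
  -- As the errors have square zero, `𝟙 - N` is the inverse of `𝟙 + N`.
  refine ⟨H ≫ (𝟙 Y - N'), H' ≫ (𝟙 X - N), ?_, ?_⟩
  · have : D ≫ H' ≫ (𝟙 X - N) + (H ≫ (𝟙 Y - N')) ≫ D' =
        (D ≫ H' + H ≫ D') ≫ (𝟙 X - N) := by
      simp only [Preadditive.add_comp, Preadditive.comp_sub, Preadditive.sub_comp, Category.assoc,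
        Category.comp_id, h₁]
      abel
    rw [this, hX]
    simp [hN]
  · have : D' ≫ H ≫ (𝟙 Y - N') + (H' ≫ (𝟙 X - N)) ≫ D =
        (D' ≫ H + H' ≫ D) ≫ (𝟙 Y - N') := by
      simp only [Preadditive.add_comp, Preadditive.comp_sub, Preadditive.sub_comp, Category.assoc,
        Category.comp_id, h₂]
      abel
    rw [this, hY]
    simp [hN']

/-- Two-periodic complexes together with a homotopy equivalence between them. -/
structure PeriodicEquiv (E₀ E₁ F₀ F₁ : V) where
  d₀ : E₀ ⟶ E₁
  d₁ : E₁ ⟶ E₀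
  e₀ : F₀ ⟶ F₁
  e₁ : F₁ ⟶ F₀
  ψ₀ : F₀ ⟶ E₀
  ψ₁ : F₁ ⟶ E₁
  φ₀ : E₀ ⟶ F₀
  φ₁ : E₁ ⟶ F₁
  h₀ : E₀ ⟶ E₁
  h₁ : E₁ ⟶ E₀
  k₀ : F₀ ⟶ F₁
  k₁ : F₁ ⟶ F₀
  d₀_d₁ : d₀ ≫ d₁ = 0
  d₁_d₀ : d₁ ≫ d₀ = 0
  e₀_e₁ : e₀ ≫ e₁ = 0
  e₁_e₀ : e₁ ≫ e₀ = 0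
  ψ₀_d₀ : ψ₀ ≫ d₀ = e₀ ≫ ψ₁
  ψ₁_d₁ : ψ₁ ≫ d₁ = e₁ ≫ ψ₀
  φ₀_e₀ : φ₀ ≫ e₀ = d₀ ≫ φ₁
  φ₁_e₁ : φ₁ ≫ e₁ = d₁ ≫ φ₀
  φ₀_ψ₀ : φ₀ ≫ ψ₀ = d₀ ≫ h₁ + h₀ ≫ d₁ + 𝟙 E₀
  φ₁_ψ₁ : φ₁ ≫ ψ₁ = d₁ ≫ h₀ + h₁ ≫ d₀ + 𝟙 E₁
  ψ₀_φ₀ : ψ₀ ≫ φ₀ = e₀ ≫ k₁ + k₀ ≫ e₁ + 𝟙 F₀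
  ψ₁_φ₁ : ψ₁ ≫ φ₁ = e₁ ≫ k₀ + k₁ ≫ e₀ + 𝟙 F₁

namespace PeriodicEquiv

variable {E₀ E₁ F₀ F₁ : V}

/-- Exchange of the two degrees. -/
def swap (S : PeriodicEquiv E₀ E₁ F₀ F₁) : PeriodicEquiv E₁ E₀ F₁ F₀ :=
  ⟨S.d₁, S.d₀, S.e₁, S.e₀, S.ψ₁, S.ψ₀, S.φ₁, S.φ₀, S.h₁, S.h₀, S.k₁, S.k₀, S.d₁_d₀, S.d₀_d₁,
    S.e₁_e₀, S.e₀_e₁, S.ψ₁_d₁, S.ψ₀_d₀, S.φ₁_e₁, S.φ₀_e₀, S.φ₁_ψ₁, S.φ₀_ψ₀, S.ψ₁_φ₁, S.ψ₀_φ₀⟩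

/-- The differential of the mapping cone of `ψ`. -/
def coneD (S : PeriodicEquiv E₀ E₁ F₀ F₁) (b : BinaryBicone F₁ E₀) (b' : BinaryBicone F₀ E₁) :
    b.pt ⟶ b'.pt :=
  squareHom b b' (-S.e₁) S.ψ₁ 0 S.d₀

/-- The contraction, up to a nilpotent error, of the mapping cone of `ψ`. -/
def coneH (S : PeriodicEquiv E₀ E₁ F₀ F₁) (b : BinaryBicone F₁ E₀) (b' : BinaryBicone F₀ E₁) :
    b.pt ⟶ b'.pt :=
  squareHom b b' S.k₁ 0 S.φ₀ (-S.h₀)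

variable (S : PeriodicEquiv E₀ E₁ F₀ F₁) (b : BinaryBicone F₁ E₀) (b' : BinaryBicone F₀ E₁)

theorem coneD_comp : S.coneD b b' ≫ S.swap.coneD b' b = 0 := by
  rw [coneD, coneD, squareHom_comp, ← squareHom_zero]
  congr 1 <;> simp [swap, S.e₁_e₀, S.d₀_d₁, S.ψ₁_d₁]

-- The homotopies on `E` and `F` are unrelated, so an error from `F` to `E` remains. It is strictly
-- triangular, hence of square zero, and `exists_contraction` removes it.
variable {b} in
theorem coneD_coneH (hb : IsBinarySum b) :
    S.coneD b b' ≫ S.swap.coneH b' b + S.coneH b b' ≫ S.swap.coneD b' b =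
      𝟙 _ + squareHom b b 0 (S.k₁ ≫ S.ψ₀ - S.ψ₁ ≫ S.h₁) 0 0 := by
  rw [coneD, coneD, coneH, coneH, squareHom_comp, squareHom_comp, ← hb.squareHom_id,
    squareHom_add, squareHom_add]
  congr 1
  · simp [swap, S.ψ₁_φ₁]; abel
  · simp [swap]; abel
  · simp [swap, S.φ₀_e₀]
  · simp [swap, S.φ₀_ψ₀]; abel

variable {b b'} in
theorem exists_cone_contraction (hb : IsBinarySum b) (hb' : IsBinarySum b') :
    ∃ (K : b.pt ⟶ b'.pt) (K' : b'.pt ⟶ b.pt),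
      S.coneD b b' ≫ K' + K ≫ S.swap.coneD b' b = 𝟙 _ ∧
      S.swap.coneD b' b ≫ K + K' ≫ S.coneD b b' = 𝟙 _ :=
  exists_contraction (S.coneD_comp b b') (S.swap.coneD_comp b' b)
    (by rw [squareHom_comp, ← squareHom_zero]; congr 1 <;> simp)
    (by rw [squareHom_comp, ← squareHom_zero]; congr 1 <;> simp)
    (S.coneD_coneH b' hb) (S.swap.coneD_coneH b hb')

end PeriodicEquiv

end TwoByTwo

/-! ### Invertibility of the operator of the folded cone -/

section ConeIso

set_option linter.unusedSectionVars false

variable {A : Type u} [CStarAlgebra A] [PartialOrder A] [StarOrderedRing A]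

namespace HilbertModule

variable {X Y : HilbertModule A}

/-- Since `D ≫ D' = 0`, the vectors `D x` and `D'* x` are orthogonal, and Pythagoras applies to
their difference. -/
theorem norm_le_of_adjoint_sub {D : X ⟶ Y} {D' : Y ⟶ X} (hD : D ≫ D' = 0) (x : X) :
    ‖toCLM D x‖ ≤ ‖toCLM (D - adjoint D') x‖ ∧
      ‖toCLM (adjoint D') x‖ ≤ ‖toCLM (D - adjoint D') x‖ := by
  have h₁ : inner A (toCLM D x) (toCLM (adjoint D') x) = 0 := by
    rw [← inner_adjoint]
    have : toCLM D' (toCLM D x) = 0 := congrArg (fun T : X ⟶ X => toCLM T x) hD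
    rw [this, CStarModule.inner_zero_left]
  have h₂ : inner A (toCLM (adjoint D') x) (toCLM D x) = 0 := by
    rw [← CStarModule.star_inner, h₁, star_zero]
  have h : inner A (toCLM (D - adjoint D') x) (toCLM (D - adjoint D') x) =
      inner A (toCLM D x) (toCLM D x) + inner A (toCLM (adjoint D') x) (toCLM (adjoint D') x) := by
    rw [toCLM_sub, sub_apply]
    simp [h₁, h₂]
  constructor <;> refine (pow_le_pow_iff_left₀ (norm_nonneg _) (norm_nonneg _) two_ne_zero).mp ?_
  all_goals
    rw [CStarModule.norm_sq_eq A, CStarModule.norm_sq_eq A, h]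
    refine CStarAlgebra.norm_le_norm_of_nonneg_of_le CStarModule.inner_self_nonneg ?_
  · exact le_add_of_nonneg_right CStarModule.inner_self_nonneg
  · exact le_add_of_nonneg_left CStarModule.inner_self_nonneg

theorem adjoint_adjoint (T : X ⟶ Y) : adjoint (adjoint T) = T :=
  adjoint_eq fun y x => inner_adjoint_left T x y

theorem adjoint_sub (S T : X ⟶ Y) : adjoint (S - T) = adjoint S - adjoint T :=
  adjoint_eq fun x y => by simp [inner_adjoint]

theorem adjoint_neg (S : X ⟶ Y) : adjoint (-S) = -adjoint S :=
  adjoint_eq fun x y => by simp [inner_adjoint]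

end HilbertModule

namespace BoundedHilbertModule

open HilbertModule

variable {X Y : HilbertModule A}

/-- The contraction gives `⟪x, x⟫ = ⟪x, K' D x⟫ + ⟪D'* x, K x⟫`, so `‖x‖` is at most `‖K'‖ + ‖K‖`
times `‖(D - D'*) x‖`. No adjoint of `K` or `K'` enters, so a bounded contraction suffices. -/
theorem isUnit_sub_adjoint {D : X ⟶ Y} {D' : Y ⟶ X} (hD : D ≫ D' = 0)
    {K : (ofAdjointable A).obj X ⟶ (ofAdjointable A).obj Y}
    {K' : (ofAdjointable A).obj Y ⟶ (ofAdjointable A).obj X}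
    (hX : (ofAdjointable A).map D ≫ K' + K ≫ (ofAdjointable A).map D' = 𝟙 _) :
    IsUnit ((toCLM (adjoint (D - adjoint D'))).comp (toCLM (D - adjoint D'))) := by
  let k : X →L[ℂ] Y := clm K
  let k' : Y →L[ℂ] X := clm K'
  refine isUnit_adjoint_comp _ _ (inner_adjoint _) (‖k'‖ + ‖k‖) fun x => ?_
  have hx : k' (toCLM D x) + toCLM D' (k x) = x :=
    congrArg (fun T : (ofAdjointable A).obj X ⟶ (ofAdjointable A).obj X => clm T x) hX
  obtain ⟨h₁, h₂⟩ := norm_le_of_adjoint_sub hD x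
  set y := toCLM (D - adjoint D') x
  rcases eq_or_ne x 0 with h0 | h0
  · rw [h0, norm_zero]; positivity
  refine le_of_mul_le_mul_left ?_ (norm_pos_iff.mpr h0)
  have e : inner A x x = inner A x (k' (toCLM D x)) + inner A (toCLM (adjoint D') x) (k x) := by
    conv_lhs => rw [← hx, CStarModule.inner_add_right, hx]
    rw [← inner_adjoint_left]
  calc ‖x‖ * ‖x‖ = ‖inner A x x‖ := by rw [← sq, CStarModule.norm_sq_eq A]
    _ ≤ ‖x‖ * ‖k' (toCLM D x)‖ + ‖toCLM (adjoint D') x‖ * ‖k x‖ := by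
        rw [e]
        exact (norm_add_le _ _).trans (add_le_add (CStarModule.norm_inner_le _)
          (CStarModule.norm_inner_le _))
    _ ≤ ‖x‖ * (‖k'‖ * ‖y‖) + ‖y‖ * (‖k‖ * ‖x‖) := by
        gcongr
        · exact (k'.le_opNorm _).trans (by gcongr)
        · exact k.le_opNorm x
    _ = _ := by ring

/-- If `D, D'` is an acyclic two-periodic complex, contractible by bounded homomorphisms, then
`D - D'*` is invertible. -/
theorem isIso_sub_adjoint {D : X ⟶ Y} {D' : Y ⟶ X} (hD : D ≫ D' = 0) (hD' : D' ≫ D = 0)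
    {K : (ofAdjointable A).obj X ⟶ (ofAdjointable A).obj Y}
    {K' : (ofAdjointable A).obj Y ⟶ (ofAdjointable A).obj X}
    (hX : (ofAdjointable A).map D ≫ K' + K ≫ (ofAdjointable A).map D' = 𝟙 _)
    (hY : (ofAdjointable A).map D' ≫ K + K' ≫ (ofAdjointable A).map D = 𝟙 _) :
    IsIso ((ofAdjointable A).map (D - adjoint D')) := by
  set f := (ofAdjointable A).map (D - adjoint D') with hf
  set g := (ofAdjointable A).map (adjoint (D - adjoint D')) with hg
  -- Exchanging the roles of `D` and `D'` replaces `D - D'*` by minus its adjoint. Hence both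
  -- products with the adjoint are invertible, giving inverses on either side.
  have e : D' - adjoint D = -adjoint (D - adjoint D') := by
    rw [adjoint_sub, adjoint_adjoint, neg_sub]
  obtain ⟨u, hu⟩ := exists_iso_of_isUnit (f ≫ g) (isUnit_sub_adjoint hD hX)
  obtain ⟨v, hv⟩ := exists_iso_of_isUnit (g ≫ f) (by
    have h := isUnit_sub_adjoint hD' hY
    have e' : adjoint (D' - adjoint D) = -(D - adjoint D') := by
      rw [e, adjoint_neg, adjoint_adjoint]
    rw [e', e, toCLM_neg, toCLM_neg, ContinuousLinearMap.neg_comp, ContinuousLinearMap.comp_neg,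
      neg_neg] at h
    exact h)
  have hr : f ≫ g ≫ u.inv = 𝟙 _ := by rw [← Category.assoc, ← hu, u.hom_inv_id]
  have hl : (v.inv ≫ g) ≫ f = 𝟙 _ := by rw [Category.assoc, ← hv, v.inv_hom_id]
  have hlr : v.inv ≫ g = g ≫ u.inv := by
    rw [← Category.comp_id (v.inv ≫ g), ← hr, ← Category.assoc, hl, Category.id_comp]
  exact ⟨g ≫ u.inv, hr, by rw [← hlr, hl]⟩

end BoundedHilbertModule

/-! ### Binary direct sums of Hilbert modules -/

namespace HilbertModule

open WithCStarModule

/-- The direct sum of two Hilbert modules. -/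
noncomputable def prodModule (X Y : HilbertModule A) : HilbertModule A where
  carrier := C⋆ᵐᵒᵈ(A, X × Y)

variable (X Y : HilbertModule A)

/-- The first projection as a bounded operator. -/
noncomputable def fstCLM : prodModule X Y →L[ℂ] X :=
  (ContinuousLinearMap.fst ℂ X Y).comp
    (equivL ℂ (A := A) (E := X × Y) : C⋆ᵐᵒᵈ(A, X × Y) →L[ℂ] (X × Y))

/-- The second projection as a bounded operator. -/
noncomputable def sndCLM : prodModule X Y →L[ℂ] Y :=
  (ContinuousLinearMap.snd ℂ X Y).comp
    (equivL ℂ (A := A) (E := X × Y) : C⋆ᵐᵒᵈ(A, X × Y) →L[ℂ] (X × Y))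

/-- The first inclusion as a bounded operator. -/
noncomputable def inlCLM : X →L[ℂ] prodModule X Y :=
  ((equivL ℂ (A := A) (E := X × Y)).symm : (X × Y) →L[ℂ] C⋆ᵐᵒᵈ(A, X × Y)).comp
    (ContinuousLinearMap.inl ℂ X Y)

/-- The second inclusion as a bounded operator. -/
noncomputable def inrCLM : Y →L[ℂ] prodModule X Y :=
  ((equivL ℂ (A := A) (E := X × Y)).symm : (X × Y) →L[ℂ] C⋆ᵐᵒᵈ(A, X × Y)).comp
    (ContinuousLinearMap.inr ℂ X Y)

variable {X Y}

theorem prodModule_ext {x y : prodModule X Y} (h₁ : fstCLM X Y x = fstCLM X Y y)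
    (h₂ : sndCLM X Y x = sndCLM X Y y) : x = y :=
  Prod.ext h₁ h₂

theorem inner_prodModule (x y : prodModule X Y) :
    inner A x y = inner A (fstCLM X Y x) (fstCLM X Y y) +
      inner A (sndCLM X Y x) (sndCLM X Y y) := rfl

@[simp] theorem fstCLM_inlCLM (x : X) : fstCLM X Y (inlCLM X Y x) = x := rfl
@[simp] theorem sndCLM_inlCLM (x : X) : sndCLM X Y (inlCLM X Y x) = 0 := rfl
@[simp] theorem fstCLM_inrCLM (y : Y) : fstCLM X Y (inrCLM X Y y) = 0 := rfl
@[simp] theorem sndCLM_inrCLM (y : Y) : sndCLM X Y (inrCLM X Y y) = y := rfl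

theorem inner_inlCLM (x : X) (y : prodModule X Y) :
    inner A (inlCLM X Y x) y = inner A x (fstCLM X Y y) := by
  rw [inner_prodModule]; simp

theorem inner_inrCLM (x : Y) (y : prodModule X Y) :
    inner A (inrCLM X Y x) y = inner A x (sndCLM X Y y) := by
  rw [inner_prodModule]; simp

theorem inner_fstCLM (x : prodModule X Y) (y : X) :
    inner A (fstCLM X Y x) y = inner A x (inlCLM X Y y) := by
  rw [inner_prodModule]; simp

theorem inner_sndCLM (x : prodModule X Y) (y : Y) :
    inner A (sndCLM X Y x) y = inner A x (inrCLM X Y y) := by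
  rw [inner_prodModule]; simp

variable (X Y) in
/-- The direct sum of two Hilbert modules as a bicone. -/
noncomputable def prodBicone : Limits.BinaryBicone X Y where
  pt := prodModule X Y
  fst := ofMem (fstCLM X Y) ⟨inlCLM X Y, inner_fstCLM⟩
  snd := ofMem (sndCLM X Y) ⟨inrCLM X Y, inner_sndCLM⟩
  inl := ofMem (inlCLM X Y) ⟨fstCLM X Y, inner_inlCLM⟩
  inr := ofMem (inrCLM X Y) ⟨sndCLM X Y, inner_inrCLM⟩
  inl_fst := rfl
  inl_snd := rfl
  inr_fst := rfl
  inr_snd := rfl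

theorem isBinarySum_prodBicone : IsBinarySum (prodBicone X Y) :=
  hom_ext fun x => prodModule_ext (add_zero (fstCLM X Y x)) (zero_add (sndCLM X Y x))

theorem adjoint_prodBicone_snd : adjoint (prodBicone X Y).snd = (prodBicone X Y).inr :=
  adjoint_eq inner_sndCLM

theorem adjoint_prodBicone_inr : adjoint (prodBicone X Y).inr = (prodBicone X Y).snd :=
  adjoint_eq inner_inrCLM

theorem corner_adjoint {P Q X Y : HilbertModule A}
    (T : (prodBicone P X).pt ⟶ (prodBicone Q Y).pt) :
    (prodBicone Q Y).inr ≫ adjoint T ≫ (prodBicone P X).snd =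
      adjoint ((prodBicone P X).inr ≫ T ≫ (prodBicone Q Y).snd) := by
  rw [adjoint_comp, adjoint_comp, adjoint_prodBicone_inr, adjoint_prodBicone_snd, Category.assoc]

end HilbertModule

namespace BoundedHilbertModule

open HilbertModule

instance : (ofAdjointable A).Faithful where
  map_injective h := HilbertModule.hom_ext fun x =>
    congrArg (fun T : (ofAdjointable A).obj _ ⟶ (ofAdjointable A).obj _ => clm T x) h

/-- A bounded homomorphism from a finitely generated module comes from `𝓛_A`. -/
theorem exists_map_eq {X Y : HilbertModule A} (hX : Module.Finite A X)
    (T : (ofAdjointable A).obj X ⟶ (ofAdjointable A).obj Y) :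
    ∃ S : X ⟶ Y, (ofAdjointable A).map S = T :=
  ⟨ofMem (clm T) (mem_adjointable_of_finite hX (clm_map_smul T)), rfl⟩

variable {E₀ E₁ F₀ F₁ : HilbertModule A}

/-- A homotopy equivalence of a two-periodic complex `E` in `𝓛_A` with a two-periodic complex `F`
of finitely generated modules gives an isomorphism `F₁ ⊕ E₀ ≅ F₀ ⊕ E₁` with the component
`d₀ - d₁*`. -/
theorem exists_cone_iso
    (S : PeriodicEquiv ((ofAdjointable A).obj E₀) ((ofAdjointable A).obj E₁)
      ((ofAdjointable A).obj F₀) ((ofAdjointable A).obj F₁))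
    (hF₀ : Module.Finite A F₀) (hF₁ : Module.Finite A F₁) {d₀ : E₀ ⟶ E₁} {d₁ : E₁ ⟶ E₀}
    (hd₀ : (ofAdjointable A).map d₀ = S.d₀) (hd₁ : (ofAdjointable A).map d₁ = S.d₁) :
    ∃ f : ((ofAdjointable A).mapBinaryBicone (prodBicone F₁ E₀)).pt ≅
        ((ofAdjointable A).mapBinaryBicone (prodBicone F₀ E₁)).pt,
      ((ofAdjointable A).mapBinaryBicone (prodBicone F₁ E₀)).inr ≫ f.hom ≫
        ((ofAdjointable A).mapBinaryBicone (prodBicone F₀ E₁)).snd =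
          (ofAdjointable A).map (d₀ - adjoint d₁) := by
  -- This is why the cone of `ψ : F → E` is used: all its new entries start in finitely generated
  -- modules and are adjointable, whereas `φ` and the homotopies of `E` are only bounded.
  obtain ⟨e₀, he₀⟩ := exists_map_eq hF₀ S.e₀
  obtain ⟨e₁, he₁⟩ := exists_map_eq hF₁ S.e₁
  obtain ⟨ψ₀, hψ₀⟩ := exists_map_eq hF₀ S.ψ₀
  obtain ⟨ψ₁, hψ₁⟩ := exists_map_eq hF₁ S.ψ₁
  let b := prodBicone F₁ E₀
  let b' := prodBicone F₀ E₁
  let D : b.pt ⟶ b'.pt := squareHom b b' (-e₁) ψ₁ 0 d₀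
  let D' : b'.pt ⟶ b.pt := squareHom b' b (-e₀) ψ₀ 0 d₁
  have hD : (ofAdjointable A).map D = S.coneD ((ofAdjointable A).mapBinaryBicone b)
      ((ofAdjointable A).mapBinaryBicone b') := by
    rw [PeriodicEquiv.coneD, map_squareHom, (ofAdjointable A).map_neg, (ofAdjointable A).map_zero,
      he₁, hψ₁, hd₀]
  have hD' : (ofAdjointable A).map D' =
      S.swap.coneD ((ofAdjointable A).mapBinaryBicone b') ((ofAdjointable A).mapBinaryBicone b) := by
    rw [PeriodicEquiv.coneD, map_squareHom, (ofAdjointable A).map_neg, (ofAdjointable A).map_zero,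
      he₀, hψ₀, hd₁]
    rfl
  obtain ⟨K, K', hK, hK'⟩ := S.exists_cone_contraction
    (isBinarySum_prodBicone.map (ofAdjointable A))
    (isBinarySum_prodBicone.map (ofAdjointable A))
    (b := (ofAdjointable A).mapBinaryBicone b) (b' := (ofAdjointable A).mapBinaryBicone b')
  rw [← hD, ← hD'] at hK hK'
  have hDD' : D ≫ D' = 0 := (ofAdjointable A).map_injective (by
    rw [(ofAdjointable A).map_comp, hD, hD', (ofAdjointable A).map_zero]
    exact S.coneD_comp _ _)
  have hD'D : D' ≫ D = 0 := (ofAdjointable A).map_injective (by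
    rw [(ofAdjointable A).map_comp, hD, hD', (ofAdjointable A).map_zero]
    exact S.swap.coneD_comp _ _)
  have : IsIso ((ofAdjointable A).map (D - adjoint D')) := isIso_sub_adjoint hDD' hD'D hK hK'
  let f := asIso ((ofAdjointable A).map (D - adjoint D'))
  refine ⟨f, ?_⟩
  change (ofAdjointable A).map b.inr ≫ (ofAdjointable A).map (D - adjoint D') ≫
    (ofAdjointable A).map b'.snd = _
  rw [← (ofAdjointable A).map_comp, ← (ofAdjointable A).map_comp, Preadditive.sub_comp,
    Preadditive.comp_sub]
  -- The corner of `D` is `d₀`, and that of `D'*` is the adjoint of the corner `d₁` of `D'`.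
  congr 2
  · exact inr_squareHom_snd _ _ _ _ _ _
  · refine (corner_adjoint D').trans ?_
    rw [inr_squareHom_snd]

end BoundedHilbertModule

end ConeIso

/-! ### Folding a homotopy equivalence -/

section FoldEquiv

set_option linter.unusedSectionVars false

open Limits

universe v w

variable {V : Type w} [Category.{v} V] [Preadditive V] {C D : CochainComplex V ℤ} {s t : Finset ℤ}

theorem isZero_of_even (hs : ∀ i ∉ s, IsZero (C.X i)) {r : Finset ℤ} :
    ∀ i ∈ ({i ∈ r | Even i} : Finset ℤ), i ∉ ({i ∈ s | Even i} : Finset ℤ) → IsZero (C.X i) :=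
  fun i hi h => hs i fun his => h (Finset.mem_filter.mpr ⟨his, (Finset.mem_filter.mp hi).2⟩)

theorem isZero_of_odd (hs : ∀ i ∉ s, IsZero (C.X i)) {r : Finset ℤ} :
    ∀ i ∈ ({i ∈ r | Odd i} : Finset ℤ), i ∉ ({i ∈ s | Odd i} : Finset ℤ) → IsZero (C.X i) :=
  fun i hi h => hs i fun his => h (Finset.mem_filter.mpr ⟨his, (Finset.mem_filter.mp hi).2⟩)

theorem coversNeighbours_even_odd (hs : ∀ i ∉ s, IsZero (C.X i)) :
    CoversNeighbours C {i ∈ s | Even i} {i ∈ s | Odd i} := by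
  intro i hi k hk h
  rw [Finset.mem_filter] at hi h
  refine hs k fun hks => h ⟨hks, ?_⟩
  rcases hk with rfl | rfl <;> grind

theorem coversNeighbours_odd_even (hs : ∀ i ∉ s, IsZero (C.X i)) :
    CoversNeighbours C {i ∈ s | Odd i} {i ∈ s | Even i} := by
  intro i hi k hk h
  rw [Finset.mem_filter] at hi h
  refine hs k fun hks => h ⟨hks, ?_⟩
  rcases hk with rfl | rfl <;> grind

/-- A homotopy equivalence of bounded complexes folded to two-periodic complexes. -/
noncomputable def foldEquiv (e : HomotopyEquiv C D) (hs : ∀ i ∉ s, IsZero (C.X i))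
    (ht : ∀ i ∉ t, IsZero (D.X i))
    {b₀ : Bicone fun i : ({i ∈ s | Even i} : Finset ℤ) => C.X i}
    {b₁ : Bicone fun i : ({i ∈ s | Odd i} : Finset ℤ) => C.X i}
    {c₀ : Bicone fun i : ({i ∈ t | Even i} : Finset ℤ) => D.X i}
    {c₁ : Bicone fun i : ({i ∈ t | Odd i} : Finset ℤ) => D.X i}
    (hb₀ : IsDirectSum b₀) (hb₁ : IsDirectSum b₁) (hc₀ : IsDirectSum c₀) (hc₁ : IsDirectSum c₁) :
    PeriodicEquiv b₀.pt b₁.pt c₀.pt c₁.pt where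
  d₀ := blockD b₀ b₁
  d₁ := blockD b₁ b₀
  e₀ := blockD c₀ c₁
  e₁ := blockD c₁ c₀
  ψ₀ := blockHom c₀ b₀ (diagHom e.inv)
  ψ₁ := blockHom c₁ b₁ (diagHom e.inv)
  φ₀ := blockHom b₀ c₀ (diagHom e.hom)
  φ₁ := blockHom b₁ c₁ (diagHom e.hom)
  h₀ := blockHom b₀ b₁ e.homotopyHomInvId.hom
  h₁ := blockHom b₁ b₀ e.homotopyHomInvId.hom
  k₀ := blockHom c₀ c₁ e.homotopyInvHomId.hom
  k₁ := blockHom c₁ c₀ e.homotopyInvHomId.hom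
  d₀_d₁ := blockD_comp_blockD _ _ _
  d₁_d₀ := blockD_comp_blockD _ _ _
  e₀_e₁ := blockD_comp_blockD _ _ _
  e₁_e₀ := blockD_comp_blockD _ _ _
  ψ₀_d₀ := (blockD_comp_diag _ _ _ _ _ (isZero_of_odd ht) (isZero_of_even hs)).symm
  ψ₁_d₁ := (blockD_comp_diag _ _ _ _ _ (isZero_of_even ht) (isZero_of_odd hs)).symm
  φ₀_e₀ := (blockD_comp_diag _ _ _ _ _ (isZero_of_odd hs) (isZero_of_even ht)).symm
  φ₁_e₁ := (blockD_comp_diag _ _ _ _ _ (isZero_of_even hs) (isZero_of_odd ht)).symm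
  φ₀_ψ₀ := (diag_comp_diag _ _ _ _ (isZero_of_even ht)).trans
    (diag_eq_of_homotopy _ _ _ hb₀ (coversNeighbours_even_odd hs))
  φ₁_ψ₁ := (diag_comp_diag _ _ _ _ (isZero_of_odd ht)).trans
    (diag_eq_of_homotopy _ _ _ hb₁ (coversNeighbours_odd_even hs))
  ψ₀_φ₀ := (diag_comp_diag _ _ _ _ (isZero_of_even hs)).trans
    (diag_eq_of_homotopy _ _ _ hc₀ (coversNeighbours_even_odd ht))
  ψ₁_φ₁ := (diag_comp_diag _ _ _ _ (isZero_of_odd hs)).trans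
    (diag_eq_of_homotopy _ _ _ hc₁ (coversNeighbours_odd_even ht))

end FoldEquiv

/-! ### Classes in `K₀` -/

section KClass

set_option linter.unusedSectionVars false

namespace FGProjective

variable {R : Type u} [Ring R]

/-- The isomorphism class of a module. -/
def toClass (M : FGProjective R) : Classes R := Quotient.mk (setoid R) M

theorem toClass_eq {M N : FGProjective R} (e : M.carrier ≃ₗ[R] N.carrier) :
    M.toClass = N.toClass :=
  Quotient.sound ⟨e⟩

theorem toClass_pi (ι : Type) [Fintype ι] : ∀ (M : ι → FGProjective R) (N : FGProjective R),
    Nonempty (N.carrier ≃ₗ[R] ∀ i, (M i).carrier) → N.toClass = ∑ i, (M i).toClass := by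
  refine Fintype.induction_empty_option (P := fun ι _ => ∀ (M : ι → FGProjective R)
    (N : FGProjective R), Nonempty (N.carrier ≃ₗ[R] ∀ i, (M i).carrier) →
      N.toClass = ∑ i, (M i).toClass) ?_ ?_ ?_ ι
  · rintro α β _ e ih M N ⟨f⟩
    let _ := Fintype.ofEquiv β e.symm
    rw [ih (fun a => M (e a)) N
      ⟨f.trans (LinearEquiv.piCongrLeft R (fun b => (M b).carrier) e).symm⟩]
    exact e.sum_comp fun b => (M b).toClass
  · rintro M N ⟨f⟩
    rw [Finset.univ_eq_empty, Finset.sum_empty]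
    exact toClass_eq (N := ⟨PUnit.{u + 1}⟩) (f.trans (0 : (∀ i : PEmpty, (M i).carrier) ≃ₗ[R] _))
  · rintro α _ ih M N ⟨f⟩
    have : Module.Projective R (∀ a, (M (some a)).carrier) := by
      classical
      exact .of_equiv' (DFinsupp.linearEquivFunOnFintype (R := R)
        (M := fun a => (M (some a)).carrier))
    rw [Fintype.sum_option, ← ih (fun a => M (some a)) ⟨∀ a, (M (some a)).carrier⟩
      ⟨LinearEquiv.refl R _⟩]
    exact toClass_eq (N := ⟨(M none).carrier × ∀ a, (M (some a)).carrier⟩)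
      (f.trans (LinearEquiv.piOptionEquivProd R))

end FGProjective

variable {A : Type u} [CStarAlgebra A] [PartialOrder A] [StarOrderedRing A]

namespace HilbertModule

variable {X Y : HilbertModule A}

/-- A finitely generated Hilbert module as a finitely generated projective module. -/
def toFGProjective (X : HilbertModule A) (hX : Module.Finite A X) : FGProjective A :=
  { carrier := X
    finite := hX
    projective := hilb_projective_of_finite }

theorem kClass_eq_of_toClass (X : HilbertModule A) (hX : Module.Finite A X) :
    kClass X hX = Algebra.GrothendieckAddGroup.of (toFGProjective X hX).toClass := rfl

/-- Classes depend only on the underlying module; isomorphisms in 𝓑_A need not preserve inner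
products. -/
theorem kClass_eq (hX : Module.Finite A X) (hY : Module.Finite A Y) (e : X ≃ₗ[A] Y) :
    kClass X hX = kClass Y hY := by
  rw [kClass_eq_of_toClass, kClass_eq_of_toClass,
    FGProjective.toClass_eq (N := toFGProjective Y hY) e]

theorem kClass_prodModule (hX : Module.Finite A X) (hY : Module.Finite A Y)
    (h : Module.Finite A (prodModule X Y)) :
    kClass (prodModule X Y) h = kClass X hX + kClass Y hY := by
  rw [kClass_eq_of_toClass, kClass_eq_of_toClass, kClass_eq_of_toClass, ← map_add]
  exact congrArg _ (FGProjective.toClass_eq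
    (N := ⟨(toFGProjective X hX).carrier × (toFGProjective Y hY).carrier⟩)
    (WithCStarModule.linearEquiv A A (X × Y)))

theorem finite_prodModule (hX : Module.Finite A X) (hY : Module.Finite A Y) :
    Module.Finite A (prodModule X Y) :=
  inferInstanceAs (Module.Finite A (X × Y))

theorem finite_directSum {ι : Type} [Fintype ι] {X : ι → HilbertModule A}
    (hX : ∀ i, Module.Finite A (X i)) : Module.Finite A (directSum X) :=
  inferInstanceAs (Module.Finite A (Π i, X i))

theorem kClass_directSum {ι : Type} [Fintype ι] {X : ι → HilbertModule A}
    (hX : ∀ i, Module.Finite A (X i)) (h : Module.Finite A (directSum X)) :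
    kClass (directSum X) h = ∑ i, kClass (X i) (hX i) := by
  rw [kClass_eq_of_toClass, FGProjective.toClass_pi ι (fun i => toFGProjective (X i) (hX i)) _
    ⟨WithCStarModule.linearEquiv A A (Π i, X i)⟩, map_sum]
  rfl

end HilbertModule

namespace BoundedHilbertModule

open HilbertModule

/-- The linear equivalence underlying an isomorphism of `𝓑_A`. -/
def linearEquivOfIso {X Y : BoundedHilbertModule A} (f : X ≅ Y) :
    X.toHilbertModule ≃ₗ[A] Y.toHilbertModule :=
  LinearEquiv.ofLinearMap (linearMap f.hom) (linearMap f.inv)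
    (LinearMap.ext fun y => congrArg (fun T : Y ⟶ Y => clm T y) f.inv_hom_id)
    (LinearMap.ext fun x => congrArg (fun T : X ⟶ X => clm T x) f.hom_inv_id)

end BoundedHilbertModule

theorem HasEulerChar.of_homotopyEquiv {C D : CochainComplex (BoundedHilbertModule A) ℤ}
    (e : HomotopyEquiv C D) {x : KZero A} (h : HasEulerChar D x) : HasEulerChar C x := by
  obtain ⟨F, t, hF, ht, ⟨e'⟩, hx⟩ := h
  exact ⟨F, t, hF, ht, ⟨e.trans e'⟩, hx⟩

-- The complex is its own finitely generated model, so its Euler characteristic does not depend on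
-- `c`.
open HilbertModule BoundedHilbertModule in
theorem hasEulerChar_double {P Q : HilbertModule A} (hP : Module.Finite A P)
    (hQ : Module.Finite A Q) (c : (ofAdjointable A).obj Q ⟶ (ofAdjointable A).obj P)
    (h01 : (ComplexShape.up ℤ).Rel 0 1) :
    HasEulerChar (HomologicalComplex.double c h01) (kClass Q hQ - kClass P hP) := by
  let e₀ := HomologicalComplex.doubleXIso₀ c h01
  let e₁ := HomologicalComplex.doubleXIso₁ c h01 (ne_of_up_rel h01)
  have hz : ∀ i, i ≠ 0 → i ≠ 1 → Limits.IsZero ((HomologicalComplex.double c h01).X i) :=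
    fun i h₀ h₁ => HomologicalComplex.isZero_double_X c h01 i h₀ h₁
  have hF : ∀ i, IsFG ((HomologicalComplex.double c h01).X i) := fun i => by
    by_cases h₀ : i = 0
    · subst h₀
      exact IsFG.retract e₀.hom e₀.inv e₀.hom_inv_id hQ
    by_cases h₁ : i = 1
    · subst h₁
      exact IsFG.retract e₁.hom e₁.inv e₁.hom_inv_id hP
    exact isAdditiveProperty_isFG.zero _ (hz i h₀ h₁)
  refine ⟨_, {0, 1}, hF, fun i hi => ?_, ⟨HomotopyEquiv.refl _⟩, ?_⟩
  · simp only [Finset.mem_insert, Finset.mem_singleton, not_or] at hi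
    exact hz i hi.1 hi.2
  · rw [Finset.sum_pair zero_ne_one, Int.negOnePow_zero, Int.negOnePow_one, one_smul,
      Units.neg_smul, one_smul, ← sub_eq_add_neg]
    congr 1
    · exact (kClass_eq _ _ (linearEquivOfIso e₀)).symm
    · exact (kClass_eq _ _ (linearEquivOfIso e₁)).symm

/-- Multiplication by a nonzero scalar as an automorphism. -/
noncomputable def smulIso {V : Type*} [Category V] [Preadditive V] [Linear ℂ V] (Y : V) {z : ℂ}
    (hz : z ≠ 0) :
    Y ≅ Y where
  hom := z • 𝟙 Y
  inv := z⁻¹ • 𝟙 Y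
  hom_inv_id := by simp [smul_smul, hz]
  inv_hom_id := by simp [smul_smul, hz]

open HilbertModule BoundedHilbertModule in
/-- Up to a scalar, the complex of an operator in `𝓑_A` is a two-term complex. -/
noncomputable def operatorComplexIso {X Y : HilbertModule A} (T : X ⟶ Y) {z : ℂ} (hz : z ≠ 0)
    (h01 : (ComplexShape.up ℤ).Rel 0 1) :
    toBounded (operatorComplex (z • T)) ≅
      HomologicalComplex.double ((ofAdjointable A).map T) h01 :=
  isoDouble h01 _ ((ofAdjointable A).mapIso (HomologicalComplex.doubleXIso₀ (z • T) h01))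
    ((ofAdjointable A).mapIso
      -- Division by `z` in degree `1` absorbs the scalar.
      (HomologicalComplex.doubleXIso₁ (z • T) h01 (ne_of_up_rel h01) ≪≫
        (smulIso Y hz).symm))
    (by
      have h : (z • T) ≫ (smulIso Y hz).inv = T := by
        rw [Iso.comp_inv_eq, smulIso, Linear.comp_smul, Category.comp_id]
      have h' : (HomologicalComplex.doubleXIso₀ (z • T) h01).hom ≫ T =
          (HomologicalComplex.double (z • T) h01).d 0 1 ≫
            (HomologicalComplex.doubleXIso₁ (z • T) h01 (ne_of_up_rel h01) ≪≫
              (smulIso Y hz).symm).hom := by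
        rw [HomologicalComplex.double_d _ _ (ne_of_up_rel h01)]
        simp only [Category.assoc, Iso.trans_hom, Iso.symm_hom, Iso.inv_hom_id_assoc, h]
      exact ((ofAdjointable A).map_comp _ _).symm.trans
        ((congrArg (ofAdjointable A).map h').trans ((ofAdjointable A).map_comp _ _)))
    (fun k h₀ h₁ => (ofAdjointable A).map_isZero
      (HomologicalComplex.isZero_double_X (z • T) h01 k h₀ h₁))

end KClass

/-! ### Euler characteristic and index -/

section EulerChar

set_option linter.unusedSectionVars false

variable {A : Type u} [CStarAlgebra A] [PartialOrder A] [StarOrderedRing A]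

open HilbertModule BoundedHilbertModule

/-- The sum of the modules of even degree of a complex that vanishes outside `s`. -/
noncomputable def evenSum (C : CochainComplex (BoundedHilbertModule A) ℤ) (s : Finset ℤ) :
    HilbertModule A :=
  directSum fun i : ({i ∈ s | Even i} : Finset ℤ) => (C.X i).toHilbertModule

/-- The sum of the modules of odd degree of a complex that vanishes outside `s`. -/
noncomputable def oddSum (C : CochainComplex (BoundedHilbertModule A) ℤ) (s : Finset ℤ) :
    HilbertModule A :=
  directSum fun i : ({i ∈ s | Odd i} : Finset ℤ) => (C.X i).toHilbertModule

variable {C F F' : CochainComplex (BoundedHilbertModule A) ℤ} {s t t' : Finset ℤ}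

theorem finite_evenSum (hF : ∀ i, Module.Finite A (F.X i).toHilbertModule) (t : Finset ℤ) :
    Module.Finite A (evenSum F t) :=
  finite_directSum fun i : ({i ∈ t | Even i} : Finset ℤ) => hF i

theorem finite_oddSum (hF : ∀ i, Module.Finite A (F.X i).toHilbertModule) (t : Finset ℤ) :
    Module.Finite A (oddSum F t) :=
  finite_directSum fun i : ({i ∈ t | Odd i} : Finset ℤ) => hF i

theorem sum_negOnePow_kClass (hF : ∀ i, Module.Finite A (F.X i).toHilbertModule) (t : Finset ℤ) :
    ∑ i ∈ t, i.negOnePow • (F.X i).toHilbertModule.kClass (hF i) =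
      kClass (evenSum F t) (finite_evenSum hF t) - kClass (oddSum F t) (finite_oddSum hF t) := by
  have h₀ : kClass (evenSum F t) (finite_evenSum hF t) =
      ∑ i ∈ t with Even i, (F.X i).toHilbertModule.kClass (hF i) :=
    (kClass_directSum (fun i : ({i ∈ t | Even i} : Finset ℤ) => hF i) _).trans
      (Finset.sum_coe_sort _ fun i => (F.X i).toHilbertModule.kClass (hF i))
  have h₁ : kClass (oddSum F t) (finite_oddSum hF t) =
      ∑ i ∈ t with Odd i, (F.X i).toHilbertModule.kClass (hF i) :=
    (kClass_directSum (fun i : ({i ∈ t | Odd i} : Finset ℤ) => hF i) _).trans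
      (Finset.sum_coe_sort _ fun i => (F.X i).toHilbertModule.kClass (hF i))
  rw [h₀, h₁, ← Finset.sum_filter_add_sum_filter_not t (fun i => Even i), sub_eq_add_neg,
    ← Finset.sum_neg_distrib]
  simp only [Int.not_even_iff_odd]
  congr 1 <;> refine Finset.sum_congr rfl fun i hi => ?_
  · rw [Int.negOnePow_even i (Finset.mem_filter.mp hi).2, one_smul]
  · rw [Int.negOnePow_odd i (Finset.mem_filter.mp hi).2, Units.neg_smul, one_smul]

/-- The differential of a complex from even to odd degrees. -/
noncomputable def evenD (C : CochainComplex (BoundedHilbertModule A) ℤ) (s : Finset ℤ) :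
    (ofAdjointable A).obj (evenSum C s) ⟶ (ofAdjointable A).obj (oddSum C s) :=
  blockD (sumBicone fun i : ({i ∈ s | Even i} : Finset ℤ) => C.X i)
    (sumBicone fun i : ({i ∈ s | Odd i} : Finset ℤ) => C.X i)

/-- The differential of a complex from odd to even degrees. -/
noncomputable def oddD (C : CochainComplex (BoundedHilbertModule A) ℤ) (s : Finset ℤ) :
    (ofAdjointable A).obj (oddSum C s) ⟶ (ofAdjointable A).obj (evenSum C s) :=
  blockD (sumBicone fun i : ({i ∈ s | Odd i} : Finset ℤ) => C.X i)
    (sumBicone fun i : ({i ∈ s | Even i} : Finset ℤ) => C.X i)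

/-- Adjointable lifts of the folded differentials are taken as data because they arise in two ways:
`C` comes from 𝓛_A, or its modules are finitely generated. -/
theorem exists_folded_cone_iso (e : HomotopyEquiv C F) (hs : ∀ i ∉ s, Limits.IsZero (C.X i))
    (ht : ∀ i ∉ t, Limits.IsZero (F.X i)) (hF : ∀ i, Module.Finite A (F.X i).toHilbertModule)
    {d₀ : evenSum C s ⟶ oddSum C s} {d₁ : oddSum C s ⟶ evenSum C s}
    (hd₀ : (ofAdjointable A).map d₀ = evenD C s) (hd₁ : (ofAdjointable A).map d₁ = oddD C s) :
    ∃ f : ((ofAdjointable A).mapBinaryBicone (prodBicone (oddSum F t) (evenSum C s))).pt ≅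
        ((ofAdjointable A).mapBinaryBicone (prodBicone (evenSum F t) (oddSum C s))).pt,
      ((ofAdjointable A).mapBinaryBicone (prodBicone (oddSum F t) (evenSum C s))).inr ≫ f.hom ≫
        ((ofAdjointable A).mapBinaryBicone (prodBicone (evenSum F t) (oddSum C s))).snd =
          (ofAdjointable A).map (d₀ - adjoint d₁) :=
  exists_cone_iso (foldEquiv e hs ht (sumBicone_total _) (sumBicone_total _) (sumBicone_total _)
    (sumBicone_total _)) (finite_evenSum hF t) (finite_oddSum hF t) hd₀ hd₁

/-- The Euler characteristic of complexes of finitely generated modules is a homotopy invariant. -/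
theorem sum_negOnePow_kClass_eq (e : HomotopyEquiv F F')
    (ht : ∀ i ∉ t, Limits.IsZero (F.X i)) (ht' : ∀ i ∉ t', Limits.IsZero (F'.X i))
    (hF : ∀ i, Module.Finite A (F.X i).toHilbertModule)
    (hF' : ∀ i, Module.Finite A (F'.X i).toHilbertModule) :
    ∑ i ∈ t, i.negOnePow • (F.X i).toHilbertModule.kClass (hF i) =
      ∑ i ∈ t', i.negOnePow • (F'.X i).toHilbertModule.kClass (hF' i) := by
  obtain ⟨d₀, hd₀⟩ := exists_map_eq (finite_evenSum hF t) (evenD F t)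
  obtain ⟨d₁, hd₁⟩ := exists_map_eq (finite_oddSum hF t) (oddD F t)
  obtain ⟨f, -⟩ := exists_folded_cone_iso e ht ht' hF' hd₀ hd₁
  -- Only the source and target of the isomorphism matter here, not its corner.
  have h : kClass (prodModule (oddSum F' t') (evenSum F t)) (finite_prodModule
      (finite_oddSum hF' t') (finite_evenSum hF t)) =
      kClass (prodModule (evenSum F' t') (oddSum F t)) (finite_prodModule
        (finite_evenSum hF' t') (finite_oddSum hF t)) :=
    kClass_eq _ _ (linearEquivOfIso f)
  rw [kClass_prodModule (finite_oddSum hF' t') (finite_evenSum hF t),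
    kClass_prodModule (finite_evenSum hF' t') (finite_oddSum hF t)] at h
  rw [sum_negOnePow_kClass, sum_negOnePow_kClass, sub_eq_sub_iff_add_eq_add, add_comm, h]

theorem HasEulerChar.unique {x y : KZero A} (hx : HasEulerChar C x) (hy : HasEulerChar C y) :
    x = y := by
  obtain ⟨F, t, hF, ht, ⟨e⟩, rfl⟩ := hx
  obtain ⟨F', t', hF', ht', ⟨e'⟩, rfl⟩ := hy
  exact sum_negOnePow_kClass_eq (e.symm.trans e') ht ht' hF hF'

theorem HasEulerChar.eulerChar_eq {x : KZero A} (h : HasEulerChar C x) : eulerChar C = x := by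
  have h' : ∃ x, HasEulerChar C x := ⟨x, h⟩
  rw [eulerChar, dif_pos h']
  exact h'.choose_spec.unique h

theorem HasEulerChar.iff_eq_eulerChar {x : KZero A} (h : HasEulerChar C x) (y : KZero A) :
    HasEulerChar C y ↔ y = eulerChar C := by
  rw [h.eulerChar_eq]
  exact ⟨fun hy => hy.unique h, fun hy => hy ▸ h⟩

/-- The complementary corner of `f⁻¹` is a map `Q → P` of finitely generated modules, and its
complex replaces that of `T`. -/
theorem hasIndex_smul_of_iso {X Y P Q : HilbertModule A} (hP : Module.Finite A P)
    (hQ : Module.Finite A Q) {T : X ⟶ Y}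
    (f : ((ofAdjointable A).mapBinaryBicone (prodBicone P X)).pt ≅
      ((ofAdjointable A).mapBinaryBicone (prodBicone Q Y)).pt)
    (hf : ((ofAdjointable A).mapBinaryBicone (prodBicone P X)).inr ≫ f.hom ≫
      ((ofAdjointable A).mapBinaryBicone (prodBicone Q Y)).snd = (ofAdjointable A).map T)
    {z : ℂ} (hz : z ≠ 0) : HasIndex (z • T) (kClass Q hQ - kClass P hP) := by
  have h01 : (ComplexShape.up ℤ).Rel 0 1 := zero_add 1
  have e := cornerHomotopyEquiv (isBinarySum_prodBicone.map (ofAdjointable A))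
    (isBinarySum_prodBicone.map (ofAdjointable A)) f h01
  rw [hf] at e
  exact (hasEulerChar_double hP hQ _ h01).of_homotopyEquiv
    ((HomotopyEquiv.ofIso (operatorComplexIso T hz h01)).trans e)

theorem map_blockHom {V W : Type*} [Category V] [Category W] [Preadditive V] [Preadditive W]
    (G : V ⥤ W) [G.Additive] {J : Type*} {X Y : J → V} {s t : Finset J}
    (b : Limits.Bicone fun i : s => X i) (b' : Limits.Bicone fun i : t => Y i)
    (M : ∀ i j, X i ⟶ Y j) :
    G.map (blockHom b b' M) =
      blockHom (X := fun i => G.obj (X i)) (Y := fun i => G.obj (Y i)) (G.mapBicone b)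
        (G.mapBicone b') fun i j => G.map (M i j) := by
  simp only [blockHom, G.map_sum, G.map_comp]
  rfl

theorem HilbertModule.adjoint_matrixHom {ι κ : Type} [Fintype ι] [Fintype κ]
    {X : ι → HilbertModule A} {Y : κ → HilbertModule A} (M : ∀ i j, X i ⟶ Y j) :
    adjoint (matrixHom M) = matrixHom fun j i => adjoint (M i j) :=
  adjoint_eq (inner_matrixCLM M)

variable (E : CochainComplex (HilbertModule A) ℤ)

/-- This brings `S^even` into the form `d₀ - d₁*` of the cone corner, up to the scalar `-i`. -/
theorem signatureBlock_eq_smul_sub_adjoint (s t : Finset ℤ) :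
    signatureBlock E s t = (-Complex.I) •
      (blockHom (sumOverBicone E s) (sumOverBicone E t) E.d -
        adjoint (blockHom (sumOverBicone E t) (sumOverBicone E s) E.d)) := by
  have h₁ : blockHom (sumOverBicone E t) (sumOverBicone E s) E.d =
      matrixHom fun (i : t) (j : s) => E.d i j := (matrixHom_eq_sum _).symm
  have h₂ : adjoint (matrixHom fun (i : t) (j : s) => E.d i j) =
      blockHom (sumOverBicone E s) (sumOverBicone E t) fun i j => adjoint (E.d j i) :=
    (adjoint_matrixHom _).trans (matrixHom_eq_sum fun (i : s) (j : t) =>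
      adjoint (E.d j i))
  rw [signatureBlock_eq, h₁]
  refine Eq.trans ?_ (congrArg (fun T => (-Complex.I) •
    (blockHom (sumOverBicone E s) (sumOverBicone E t) E.d - T)) h₂.symm)
  simp only [blockHom, ← Finset.sum_sub_distrib, Finset.smul_sum, ← Preadditive.comp_sub,
    ← Preadditive.sub_comp, signatureComponent, Linear.comp_smul, Linear.smul_comp]
  rfl

variable {E}

/-- Any finitely generated model of `E` computes the index: its odd and even parts are the modules
`P` and `Q` that complete `S^even`, up to a scalar, to an isomorphism. -/
theorem hasIndex_signatureEven (hs : ∀ i ∉ s, Limits.IsZero (E.X i)) {x : KZero A}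
    (hx : HasEulerChar (toBounded E) x) : HasIndex (signatureEven E s) x := by
  obtain ⟨F, t, hF, ht, ⟨e⟩, rfl⟩ := hx
  let b₀ := sumOverBicone E {i ∈ s | Even i}
  let b₁ := sumOverBicone E {i ∈ s | Odd i}
  have hd₀ : (ofAdjointable A).map (blockHom b₀ b₁ E.d) = evenD (toBounded E) s :=
    map_blockHom _ _ _ _
  have hd₁ : (ofAdjointable A).map (blockHom b₁ b₀ E.d) = oddD (toBounded E) s :=
    map_blockHom _ _ _ _
  have hz : ∀ i ∉ s, Limits.IsZero ((toBounded E).X i) := fun i hi =>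
    (ofAdjointable A).map_isZero (hs i hi)
  obtain ⟨f, hf⟩ := exists_folded_cone_iso e hz ht hF hd₀ hd₁
  rw [sum_negOnePow_kClass, signatureEven, signatureBlock_eq_smul_sub_adjoint]
  exact hasIndex_smul_of_iso _ _ f hf (neg_ne_zero.mpr Complex.I_ne_zero)

end EulerChar

theorem proposition1p4 {A : Type u} [CStarAlgebra A] [PartialOrder A] [StarOrderedRing A]
    (E : CochainComplex (HilbertModule A) ℤ) (s : Finset ℤ)
    (hs : ∀ i ∉ s, Limits.IsZero (E.X i))
    (hS : HilbertModule.IsFredholm (signatureOp E s)) :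
    IsFredholmComplex E ∧
      HilbertModule.IsFredholm (signatureEven E s) ∧
      (∀ x : KZero A, HasEulerChar (toBounded E) x ↔ x = eulerChar (toBounded E)) ∧
      (∀ x : KZero A, HasIndex (signatureEven E s) x ↔ x = fredholmIndex (signatureEven E s)) ∧
      fredholmIndex (signatureEven E s) = eulerChar (toBounded E) := by
  have hE := isFredholmComplex_of_isFredholm hs hS
  obtain ⟨x, hx⟩ := BoundedHilbertModule.exists_hasEulerChar
    (BoundedHilbertModule.isHomotopyFinite_of_isFredholmComplex hE) s fun i hi =>
      (BoundedHilbertModule.ofAdjointable A).map_isZero (hs i hi)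
  have hi : HasEulerChar (toBounded (operatorComplex (signatureEven E s))) x :=
    hasIndex_signatureEven hs hx
  -- The two equivalences contain existence and independence of the model; with the witness `x`, the
  -- default value `0` in `eulerChar` is never used.
  exact ⟨hE, isFredholm_signatureEven hS, hx.iff_eq_eulerChar, hi.iff_eq_eulerChar,
    hi.eulerChar_eq.trans hx.eulerChar_eq.symm⟩
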